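/- Theorem 3.10 (Lower bound). Let $d\ge 1$ and let $J:\mathbb{R}^d\to[0,\infty)$ be integrable with $$\int J(x)\,dx=1,\qquad \int J(x)\,x\,dx=0,\qquad \int J(x)\,x_ix_j\,dx=2\delta_{ij}\quad(1\le i,j\le d).$$ Assume that $\int J(x)|x|^{2+s}\,dx<\infty$ for some $s\in(0,1]$ and that $J\in L^p(\mathbb{R}^d)$ for some $p\in(1,\infty]$. For $\varepsilon>0$ put $J_\varepsilon(x)=\varepsilon^{-d}J(x/\varepsilon)$, and consider the nonlocal Fokker–Planck equation $$\partial_t u=\frac1{\varepsilon^2}(J_\varepsilon * u-u)+\operatorname{div}(xu),\qquad u(0,\cdot)=u_0. \tag{NLFP}$$ For $k\ge 0$ let $L^1_k$ be the space of functions on $\mathbb{R}^d$ with norm $\int(1+|x|^k)|f(x)|\,dx<\infty$. For $T\in(0,\infty]$ and $u_0\in L^1_k$, a mild solution of (NLFP) on $[0,T)$ in $L^1_k$ is a function $u\in C([0,T),L^1_k)$ such that $$u(\tau)=T_\tau u_0+\frac1{\varepsilon^2}\int_0^\tau T_{\tau-\sigma}[J_\varepsilon * u(\sigma)]\,d\sigma\quad\text{for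 all }\tau\in[0,T),\qquad (T_\tau f)(x)=e^{(d-1/\varepsilon^2)\tau}f(e^\tau x),$$ with a Bochner integral in $L^1_k$. Then for every $t>0$, $R_1>0$ and $R_2>0$ there is a constant $\alpha>0$, depending only on $d$, $J$, $s$, $p$, $t$, $R_1$, $R_2$ (in particular independent of $\varepsilon$ and of $u_0$), such that for every $\varepsilon\in(0,1]$, every $k\ge0$, every probability density $u_0\in L^1_k$ (that is, $u_0\ge0$ almost everywhere and $\int u_0=1$), every $T\in(t,\infty]$ and every mild solution $u$ of (NLFP) on $[0,T)$ in $L^1_k$ with initial condition $u_0$, $$u(t,x)\ge\alpha\int_{B_{R_2}}u_0(y)\,dy\qquad\text{for almost every }x\in B_{R_1},$$ where $B_R$ is the ball of radius $R$ centred at $0$. -/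

import Mathlib

open MeasureTheory

namespace NLFP

/-- The space ℝᵈ with the Euclidean norm and Lebesgue measure. -/
abbrev Space (d : ℕ) : Type := EuclideanSpace ℝ (Fin d)

/-- Conditions on the kernel: it is nonnegative, integrable, of mass one, centred, and with second
moments `∫ J(x) xᵢ xⱼ dx = 2 δᵢⱼ`. (All moments written here converge: a divergent diagonal second
moment would be a Bochner integral equal to `0`, not `2`.) -/
structure IsNormalizedKernel {d : ℕ} (J : Space d → ℝ) : Prop where
  nonneg : ∀ x, 0 ≤ J x
  integrable : Integrable J
  mass : ∫ x, J x = 1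
  mean : ∫ x, J x • x = 0
  second : ∀ i j : Fin d, ∫ x, J x * (x i * x j) = if i = j then 2 else 0

/-- The scaled kernel `J_ε(x) = ε⁻ᵈ J(x / ε)`. -/
noncomputable def scaledKernel {d : ℕ} (J : Space d → ℝ) (ε : ℝ) (x : Space d) : ℝ :=
  (ε ^ d)⁻¹ * J (ε⁻¹ • x)

/-- The convolution `(J_ε * f)(x) = ∫ J_ε(y) f(x - y) dy`. -/
noncomputable def jump {d : ℕ} (J : Space d → ℝ) (ε : ℝ) (f : Space d → ℝ) : Space d → ℝ :=
  convolution (scaledKernel J ε) f (ContinuousLinearMap.mul ℝ ℝ) volume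

/-- `(T_t f)(x) = exp((d - 1/ε²) t) f(eᵗ x)`, the solution operator of
`∂ₜ u = div (x u) - u / ε²`. -/
noncomputable def transport {d : ℕ} (ε t : ℝ) (f : Space d → ℝ) (x : Space d) : ℝ :=
  Real.exp (((d : ℝ) - 1 / ε ^ 2) * t) * f (Real.exp t • x)

/-- The measure `(1 + |x|ᵏ) dx`. -/
noncomputable def weightedMeasure (d : ℕ) (k : ℝ) : Measure (Space d) :=
  volume.withDensity fun x => ENNReal.ofReal (1 + ‖x‖ ^ k)

/-- The Banach space `L¹_k` of (classes of) functions with `∫ (1 + |x|ᵏ) |f(x)| dx < ∞`, normed by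
that integral. -/
abbrev WeightedL1 (d : ℕ) (k : ℝ) : Type := Lp ℝ 1 (weightedMeasure d k)

/-- `u` is a mild solution on `[0, T)` in `L¹_k` of
`∂ₜ u = ε⁻² (J_ε * u - u) + div (x u)`, `u(0) = u₀`:
`u ∈ C([0, T), L¹_k)` and `u(t) = T_t u₀ + ε⁻² ∫₀ᵗ T_{t-s} [J_ε * u(s)] ds` for `t ∈ [0, T)`, with
a Bochner integral in `L¹_k`. Here `v` is the element `T_t u₀` of `L¹_k`, and `g s` is the element
`T_{t-s} [J_ε * u(s)]` of `L¹_k`. -/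
structure IsMildSolution {d : ℕ} (J : Space d → ℝ) (ε k : ℝ) (T : EReal)
    (u₀ : Space d → ℝ) (u : ℝ → WeightedL1 d k) : Prop where
  continuousOn : ContinuousOn u {t : ℝ | 0 ≤ t ∧ (t : EReal) < T}
  duhamel : ∀ t : ℝ, 0 ≤ t → (t : EReal) < T →
    ∃ (v : WeightedL1 d k) (g : ℝ → WeightedL1 d k),
      v =ᵐ[volume] transport ε t u₀ ∧
      (∀ s ∈ Set.Icc 0 t, g s =ᵐ[volume] transport ε (t - s) (jump J ε (u s))) ∧
      IntervalIntegrable g volume 0 t ∧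
      u t = v + (1 / ε ^ 2) • ∫ s in (0 : ℝ)..t, g s

end NLFP

/-! The solution is the law of a random variable: `u(t)` is the density of `e⁻ᵗ X₀ + ε (Y₁ + ... +
Y_N)`, where `X₀` has density `u₀`, `N` is Poisson of parameter `t / ε²`, and each `Yᵢ` is a
`J`-distributed jump made at a uniform time in `(0, t]` and contracted by the drift since. This is
read off on the Fourier side: along the characteristics of the drift the Duhamel formula becomes a
scalar Volterra equation, solved by an exponential (`IsMildSolution.fourierMode_eq`), and that
exponential is the characteristic function of a compound Poisson law.

It remains to bound the compound Poisson law below, uniformly in `ε`. With probability at least one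
half, for large rates, `N` is comparable to `t / ε²`, so `ε √N` lies between two positive constants
depending only on `t`. The local limit theorem (`exists_smul_volume_restrict_ball_le_map_convPow`)
then yields a multiple of Lebesgue measure on any ball. When `ε` is bounded below, a single
well-chosen value of `N` is enough (`exists_smul_restrict_ball_le_compoundPoisson`).

An unbounded jump density may lack a square integrable characteristic function, so the local limit
theorem splits the law as `μ₁ + μ₂` with `μ₁` of bounded density and keeps only the part of the
convolution power with at least two factors `μ₁`: its transform is integrable and what is dropped is
exponentially small.

Finally the bound on the ball of radius `R₁ + R₂` is convolved with the law of `e⁻ᵗ X₀`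
(`smul_restrict_ball_le_conv`). -/

set_option linter.unusedSectionVars false

/-! ### Weak Fourier inversion for finite measures. -/

section FourierInversion

open Filter Topology Complex Module
open scoped RealInnerProductSpace

variable {E : Type*} [NormedAddCommGroup E] [InnerProductSpace ℝ E] [FiniteDimensional ℝ E]
  [MeasurableSpace E] [BorelSpace E]

/-- The Gaussian kernel whose Fourier transform is `η ↦ exp (-‖η‖² / c)`. -/
noncomputable def gaussKernel (E : Type*) [NormedAddCommGroup E] [InnerProductSpace ℝ E]
    (c : ℝ) (v : E) : ℂ :=
  (Real.pi * c : ℂ) ^ (finrank ℝ E / 2 : ℂ) * cexp (-Real.pi ^ 2 * c * ‖v‖ ^ 2)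

lemma gaussKernel_eq_ofReal {c : ℝ} (hc : 0 < c) (v : E) :
    gaussKernel E c v = (((Real.pi * c) ^ (finrank ℝ E / 2 : ℝ) *
      Real.exp (-Real.pi ^ 2 * c * ‖v‖ ^ 2) : ℝ) : ℂ) := by
  rw [gaussKernel, ofReal_mul, ofReal_cpow (by positivity)]
  push_cast
  rfl

lemma continuous_gaussKernel (c : ℝ) : Continuous (gaussKernel E c) := by
  unfold gaussKernel; fun_prop

lemma integral_cexp_mul_gaussian {c : ℝ} (hc : 0 < c) (x : E) :
    ∫ η : E, cexp (-(c⁻¹ : ℝ) * ‖η‖ ^ 2) * cexp (⟪x, (2 * Real.pi) • η⟫ * I) =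
      gaussKernel E c x := by
  have := GaussianFourier.integral_cexp_neg_mul_sq_norm_add (b := ((c⁻¹ : ℝ) : ℂ))
    (by simpa using hc) (2 * Real.pi * I) x
  rw [gaussKernel]
  convert this using 2
  · ext η
    rw [← Complex.exp_add, inner_smul_right]
    push_cast
    ring_nf
  · push_cast; rw [div_inv_eq_mul]
  · congr 1
    push_cast
    have : (c : ℂ) ≠ 0 := by exact_mod_cast hc.ne'
    field_simp
    ring_nf
    simp

/-- Convolving a finite measure with the Gaussian kernel multiplies its characteristic function by
a Gaussian. -/
lemma integral_gaussKernel_sub (κ : Measure E) [IsFiniteMeasure κ] {c : ℝ} (hc : 0 < c) (w : E) :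
    ∫ v, gaussKernel E c (v - w) ∂κ =
      ∫ η : E, cexp (-(c⁻¹ : ℝ) * ‖η‖ ^ 2) *
        (cexp (-⟪w, (2 * Real.pi) • η⟫ * I) * charFun κ ((2 * Real.pi) • η)) := by
  have hint : Integrable (Function.uncurry fun (v η : E) =>
      cexp (-(c⁻¹ : ℝ) * ‖η‖ ^ 2) * cexp (⟪v - w, (2 * Real.pi) • η⟫ * I)) (κ.prod volume) := by
    have h1 : Integrable (fun η : E => cexp (-(c⁻¹ : ℝ) * ‖η‖ ^ 2)) := by
      simpa using GaussianFourier.integrable_cexp_neg_mul_sq_norm_add (b := ((c⁻¹ : ℝ) : ℂ))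
        (by simpa using hc) 0 (0 : E)
    have h2 : Integrable (fun p : E × E => (1 : ℂ) * cexp (-(c⁻¹ : ℝ) * ‖p.2‖ ^ 2))
        (κ.prod volume) := (integrable_const (1 : ℂ)).mul_prod h1
    refine h2.mono ?_ ?_
    · apply Continuous.aestronglyMeasurable
      unfold Function.uncurry
      fun_prop
    · refine Eventually.of_forall fun p => ?_
      simp only [Function.uncurry, norm_mul, one_mul, norm_exp_ofReal_mul_I, mul_one]
      simp
  calc ∫ v, gaussKernel E c (v - w) ∂κ
      = ∫ v, (∫ η : E, cexp (-(c⁻¹ : ℝ) * ‖η‖ ^ 2) *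
          cexp (⟪v - w, (2 * Real.pi) • η⟫ * I)) ∂κ := by
        simp_rw [integral_cexp_mul_gaussian hc]
    _ = ∫ η : E, ∫ v, cexp (-(c⁻¹ : ℝ) * ‖η‖ ^ 2) *
          cexp (⟪v - w, (2 * Real.pi) • η⟫ * I) ∂κ := integral_integral_swap hint
    _ = _ := by
        congr with η
        rw [charFun_apply, ← integral_const_mul, ← integral_const_mul]
        congr with v
        rw [← Complex.exp_add, ← Complex.exp_add, ← Complex.exp_add, inner_sub_left]
        push_cast
        ring_nf

lemma tendsto_integral_gaussKernel_mul {ψ : E → ℂ} (hψ : Integrable ψ) (hc : Continuous ψ)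
    (v : E) :
    Tendsto (fun c : ℝ => ∫ w, gaussKernel E c (v - w) * ψ w) atTop (𝓝 (ψ v)) := by
  simpa [gaussKernel] using Real.tendsto_integral_gaussian_smul' hψ (hc.continuousAt (x := v))

lemma integral_norm_gaussKernel {c : ℝ} (hc : 0 < c) : ∫ v : E, ‖gaussKernel E c v‖ = 1 := by
  have h : ∀ v : E, ‖gaussKernel E c v‖ = (Real.pi * c) ^ (finrank ℝ E / 2 : ℝ) *
      Real.exp (-(Real.pi ^ 2 * c) * ‖v‖ ^ 2) := by
    intro v
    rw [gaussKernel_eq_ofReal hc, norm_real, Real.norm_of_nonneg (by positivity), neg_mul]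
  simp_rw [h]
  rw [integral_const_mul, GaussianFourier.integral_rexp_neg_mul_sq_norm (by positivity),
    ← Real.mul_rpow (by positivity) (by positivity)]
  have : Real.pi * c * (Real.pi / (Real.pi ^ 2 * c)) = 1 := by
    have := Real.pi_pos
    field_simp
  rw [this, Real.one_rpow]

lemma integrable_gaussKernel {c : ℝ} (hc : 0 < c) : Integrable (gaussKernel E c) := by
  -- The integral of a non-integrable norm is `0` by default, against the value `1` just computed.
  by_contra h
  have h1 := integral_norm_gaussKernel (E := E) hc
  rw [integral_undef (by
    rwa [integrable_norm_iff (continuous_gaussKernel c).aestronglyMeasurable])] at h1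
  exact zero_ne_one h1

/-- A finite measure with integrable characteristic function, tested against a continuous compactly
supported function: weak form of Fourier inversion. -/
lemma integral_eq_integral_mul_inverse_charFun (κ : Measure E) [IsFiniteMeasure κ]
    (hκ : Integrable fun η : E => charFun κ ((2 * Real.pi) • η))
    {ψ : E → ℂ} (hψ : Continuous ψ) (hψc : HasCompactSupport ψ) :
    ∫ v, ψ v ∂κ = ∫ w, (∫ η : E, cexp (-⟪w, (2 * Real.pi) • η⟫ * I) *
      charFun κ ((2 * Real.pi) • η)) * ψ w := by
  have hψi : Integrable ψ := hψ.integrable_of_hasCompactSupport hψc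
  obtain ⟨M, hM⟩ := hψc.exists_bound_of_continuous hψ
  -- smoothing in the space variable
  have h1 : Tendsto (fun c : ℝ => ∫ v, (∫ w, gaussKernel E c (v - w) * ψ w) ∂κ) atTop
      (𝓝 (∫ v, ψ v ∂κ)) := by
    refine tendsto_integral_filter_of_dominated_convergence (fun _ => M) ?_ ?_
      (integrable_const M) ?_
    · refine Eventually.of_forall fun c => ?_
      apply StronglyMeasurable.aestronglyMeasurable
      apply StronglyMeasurable.integral_prod_right
      apply Continuous.stronglyMeasurable
      have := continuous_gaussKernel (E := E) c
      fun_prop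
    · filter_upwards [eventually_gt_atTop 0] with c hc
      refine Eventually.of_forall fun v => ?_
      calc ‖∫ w, gaussKernel E c (v - w) * ψ w‖ ≤ ∫ w, ‖gaussKernel E c (v - w)‖ * M := by
            refine norm_integral_le_of_norm_le ?_ (Eventually.of_forall fun w => ?_)
            · exact (((integrable_gaussKernel hc).comp_sub_left v).norm).mul_const M
            · rw [norm_mul]
              gcongr
              exact hM w
        _ = M := by
            rw [integral_mul_const, integral_sub_left_eq_self (fun w => ‖gaussKernel E c w‖),
              integral_norm_gaussKernel hc, one_mul]
    · exact Eventually.of_forall fun v => tendsto_integral_gaussKernel_mul hψi hψ v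
  -- smoothing in the frequency variable
  have hF : ∀ w : E, Integrable fun η : E =>
      cexp (-⟪w, (2 * Real.pi) • η⟫ * I) * charFun κ ((2 * Real.pi) • η) := by
    intro w
    refine hκ.mono ?_ (Eventually.of_forall fun η => ?_)
    · exact (Continuous.aestronglyMeasurable (by fun_prop)).mul hκ.1
    · rw [norm_mul, ← ofReal_neg, norm_exp_ofReal_mul_I, one_mul]
  set F : ℝ → E → ℂ := fun c w => ∫ η : E, cexp (-(c⁻¹ : ℝ) * ‖η‖ ^ 2) *
        (cexp (-⟪w, (2 * Real.pi) • η⟫ * I) * charFun κ ((2 * Real.pi) • η)) with hFdef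
  have hexp : ∀ c : ℝ, 0 < c → ∀ η : E, ‖cexp (-(c⁻¹ : ℝ) * ‖η‖ ^ 2)‖ ≤ 1 := by
    intro c hc η
    have : (-(c⁻¹ : ℝ) * ‖η‖ ^ 2 : ℂ) = ((-(c⁻¹) * ‖η‖ ^ 2 : ℝ) : ℂ) := by push_cast; ring
    rw [this, ← ofReal_exp, norm_real, Real.norm_of_nonneg (Real.exp_pos _).le, Real.exp_le_one_iff]
    have : 0 ≤ c⁻¹ * ‖η‖ ^ 2 := by positivity
    linarith
  have hn : ∀ w η : E, ‖cexp (-⟪w, (2 * Real.pi) • η⟫ * I) * charFun κ ((2 * Real.pi) • η)‖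
      = ‖charFun κ ((2 * Real.pi) • η)‖ := by
    intro w η
    rw [norm_mul, ← ofReal_neg, norm_exp_ofReal_mul_I, one_mul]
  have hFb : ∀ c : ℝ, 0 < c → ∀ w, ‖F c w‖ ≤ ∫ η : E, ‖charFun κ ((2 * Real.pi) • η)‖ := by
    intro c hc w
    refine norm_integral_le_of_norm_le hκ.norm (Eventually.of_forall fun η => ?_)
    rw [norm_mul, hn]
    exact mul_le_of_le_one_left (norm_nonneg _) (hexp c hc η)
  have h2 : Tendsto (fun c : ℝ => ∫ w, F c w * ψ w) atTop (𝓝 (∫ w, (∫ η : E,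
      cexp (-⟪w, (2 * Real.pi) • η⟫ * I) * charFun κ ((2 * Real.pi) • η)) * ψ w)) := by
    refine tendsto_integral_filter_of_dominated_convergence
      (fun w => (∫ η : E, ‖charFun κ ((2 * Real.pi) • η)‖) * ‖ψ w‖) ?_ ?_
      (hψi.norm.const_mul _) ?_
    · refine Eventually.of_forall fun c => ?_
      refine AEStronglyMeasurable.mul ?_ hψ.aestronglyMeasurable
      apply StronglyMeasurable.aestronglyMeasurable
      apply StronglyMeasurable.integral_prod_right
      refine StronglyMeasurable.mul (Continuous.stronglyMeasurable (by fun_prop)) ?_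
      refine StronglyMeasurable.mul (Continuous.stronglyMeasurable (by fun_prop)) ?_
      exact stronglyMeasurable_charFun.comp_measurable (by fun_prop)
    · filter_upwards [eventually_gt_atTop 0] with c hc
      refine Eventually.of_forall fun w => ?_
      rw [norm_mul]
      gcongr
      exact hFb c hc w
    · refine Eventually.of_forall fun w => Tendsto.mul_const _ ?_
      have := Real.tendsto_integral_cexp_sq_smul (hF w)
      simpa [hFdef] using this
  -- For each `c > 0` the two smoothed integrals agree by Fubini and `integral_gaussKernel_sub`,
  -- hence so do their limits.
  refine tendsto_nhds_unique h1 (h2.congr' ?_)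
  filter_upwards [eventually_gt_atTop 0] with c hc
  have hint : Integrable (Function.uncurry fun (v w : E) => gaussKernel E c (v - w) * ψ w)
      (κ.prod volume) := by
    have hb : Integrable (fun p : E × E => (1 : ℂ) * ψ p.2) (κ.prod volume) :=
      (integrable_const (1 : ℂ)).mul_prod hψi
    have hcont := continuous_gaussKernel (E := E) c
    refine (hb.const_mul ((Real.pi * c) ^ (finrank ℝ E / 2 : ℝ) : ℝ)).mono
      (Continuous.aestronglyMeasurable (by unfold Function.uncurry; fun_prop))
      (Eventually.of_forall fun p => ?_)
    simp only [Function.uncurry, norm_mul, one_mul, norm_real]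
    gcongr
    rw [gaussKernel_eq_ofReal hc, norm_real, Real.norm_of_nonneg (by positivity),
      Real.norm_of_nonneg (by positivity)]
    refine mul_le_of_le_one_right (by positivity) (Real.exp_le_one_iff.2 ?_)
    have : 0 ≤ Real.pi ^ 2 * c * ‖p.1 - p.2‖ ^ 2 := by positivity
    linarith
  rw [integral_integral_swap hint]
  congr with w
  rw [integral_mul_const, integral_gaussKernel_sub κ hc w]

/-- If the inverse Fourier integral of the characteristic function of `κ` is at least `c` on the
open set `U`, then `κ` dominates `c` times Lebesgue measure on `U`. -/
lemma smul_volume_restrict_le_of_inverse_charFun (κ : Measure E) [IsFiniteMeasure κ]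
    (hκ : Integrable fun η : E => charFun κ ((2 * Real.pi) • η)) {U : Set E} (hU : IsOpen U)
    {c : ℝ} (hc : 0 ≤ c)
    (hcU : ∀ w ∈ U, c ≤ (∫ η : E, cexp (-⟪w, (2 * Real.pi) • η⟫ * I) *
      charFun κ ((2 * Real.pi) • η)).re) :
    ENNReal.ofReal c • volume.restrict U ≤ κ := by
  -- For open sets, inner regularity of Lebesgue measure reduces to a compact `F ⊆ V`, and a cutoff
  -- between `F` and `V` is the test function. Outer regularity of `κ` then extends the bound to
  -- measurable sets.
  have hopen : ∀ V ⊆ U, IsOpen V → ENNReal.ofReal c * volume V ≤ κ V := by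
    intro V hVU hV
    rw [hV.measure_eq_iSup_isCompact volume, ENNReal.mul_iSup]
    refine iSup_le fun F => ?_
    rw [ENNReal.mul_iSup]
    refine iSup_le fun hFV => ?_
    rw [ENNReal.mul_iSup]
    refine iSup_le fun hF => ?_
    obtain ⟨f, hf1, hf0, hfc, hf⟩ := exists_continuous_one_zero_of_isCompact hF
      hV.isClosed_compl (Set.disjoint_compl_right_iff_subset.2 hFV)
    have hψ : Continuous fun x => (f x : ℂ) := by fun_prop
    have hψc : HasCompactSupport fun x => (f x : ℂ) := hfc.comp_left (g := ofReal) (by simp)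
    have key := congrArg re (integral_eq_integral_mul_inverse_charFun κ hκ hψ hψc)
    set G : E → ℂ := fun w => ∫ η : E, cexp (-⟪w, (2 * Real.pi) • η⟫ * I) *
      charFun κ ((2 * Real.pi) • η) with hG
    have hfi : Integrable (fun x => f x) := f.continuous.integrable_of_hasCompactSupport hfc
    have hGm : AEStronglyMeasurable G volume := by
      apply StronglyMeasurable.aestronglyMeasurable
      apply StronglyMeasurable.integral_prod_right
      refine StronglyMeasurable.mul (Continuous.stronglyMeasurable (by fun_prop)) ?_
      exact stronglyMeasurable_charFun.comp_measurable (by fun_prop)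
    have hGb : ∀ w, ‖G w‖ ≤ ∫ η : E, ‖charFun κ ((2 * Real.pi) • η)‖ := by
      intro w
      refine norm_integral_le_of_norm_le hκ.norm (Eventually.of_forall fun η => ?_)
      rw [norm_mul, ← ofReal_neg, norm_exp_ofReal_mul_I, one_mul]
    have hGi : Integrable fun w => G w * (f w : ℂ) :=
      (hfi.ofReal (𝕜 := ℂ)).bdd_mul hGm (Eventually.of_forall hGb)
    have hfκ : Integrable (fun x => f x) κ :=
      f.continuous.integrable_of_hasCompactSupport hfc
    rw [integral_complex_ofReal, ofReal_re] at key
    have hre : (∫ w, G w * (f w : ℂ)).re = ∫ w, (G w).re * f w := by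
      rw [show (∫ w, G w * (f w : ℂ)).re = RCLike.re (∫ w, G w * (f w : ℂ)) from rfl,
        ← integral_re hGi]
      congr with w
      simp
    rw [hre] at key
    have h1 : c * ∫ w, f w ≤ ∫ v, f v ∂κ := by
      rw [key, ← integral_const_mul]
      refine integral_mono (hfi.const_mul c) ?_ fun w => ?_
      · have := hGi.re
        refine this.congr (Eventually.of_forall fun w => ?_)
        simp
      · by_cases hw : w ∈ V
        · exact mul_le_mul_of_nonneg_right (hcU w (hVU hw)) (hf w).1
        · have : f w = 0 := hf0 hw
          simp [this]
    have h2 : volume F ≤ ENNReal.ofReal (∫ w, f w) := by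
      rw [ofReal_integral_eq_lintegral_ofReal hfi (Eventually.of_forall fun w => (hf w).1),
        ← lintegral_indicator_one hF.measurableSet]
      refine lintegral_mono fun w => ?_
      by_cases hw : w ∈ F
      · simp [hw, hf1 hw]
      · simp [hw]
    have h3 : ENNReal.ofReal (∫ v, f v ∂κ) ≤ κ V := by
      rw [ofReal_integral_eq_lintegral_ofReal hfκ (Eventually.of_forall fun w => (hf w).1),
        ← lintegral_indicator_one hV.measurableSet]
      refine lintegral_mono fun w => ?_
      by_cases hw : w ∈ V
      · simp [hw, (hf w).2]
      · have : f w = 0 := hf0 hw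
        simp [hw, this]
    calc ENNReal.ofReal c * volume F ≤ ENNReal.ofReal c * ENNReal.ofReal (∫ w, f w) := by gcongr
      _ = ENNReal.ofReal (c * ∫ w, f w) := (ENNReal.ofReal_mul hc).symm
      _ ≤ ENNReal.ofReal (∫ v, f v ∂κ) := ENNReal.ofReal_le_ofReal h1
      _ ≤ κ V := h3
  refine Measure.le_iff.2 fun A hA => ?_
  rw [Measure.smul_apply, Measure.restrict_apply hA, smul_eq_mul]
  refine le_trans ?_ (measure_mono (Set.inter_subset_left : A ∩ U ⊆ A))
  refine le_of_forall_gt fun r hr => ?_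
  obtain ⟨V, hV, hVo, hVr⟩ := Set.exists_isOpen_lt_of_lt (A ∩ U) r hr
  calc ENNReal.ofReal c * volume (A ∩ U) ≤ ENNReal.ofReal c * volume (V ∩ U) :=
        mul_le_mul_right (measure_mono (Set.subset_inter hV Set.inter_subset_right)) _
    _ ≤ κ (V ∩ U) := hopen _ Set.inter_subset_right (hVo.inter hU)
    _ ≤ κ V := measure_mono Set.inter_subset_left
    _ < r := hVr

end FourierInversion

/-! ### Characteristic functions of absolutely continuous measures. -/

section CharFunAbsolutelyContinuous

open Filter Topology Complex Module
open scoped RealInnerProductSpace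

variable {E : Type*} [NormedAddCommGroup E] [InnerProductSpace ℝ E] [FiniteDimensional ℝ E]
  [MeasurableSpace E] [BorelSpace E]

lemma charFun_add_measure (μ ν : Measure E) [IsFiniteMeasure μ] [IsFiniteMeasure ν] (ξ : E) :
    charFun (μ + ν) ξ = charFun μ ξ + charFun ν ξ := by
  simp only [charFun_eq_integral_innerProbChar]
  exact integral_add_measure (BoundedContinuousFunction.integrable _ _)
    (BoundedContinuousFunction.integrable _ _)

lemma charFun_smul_measure (c : ENNReal) (μ : Measure E) (ξ : E) :
    charFun (c • μ) ξ = c.toReal * charFun μ ξ := by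
  simp [charFun_apply, integral_smul_measure]

/-- An absolutely continuous probability measure has a nontrivial part with density at most `1`. -/
lemma exists_add_eq_and_le_volume (μ : Measure E) [IsProbabilityMeasure μ] (hμ : μ ≪ volume) :
    ∃ μ₁ μ₂ : Measure E, IsFiniteMeasure μ₁ ∧ IsFiniteMeasure μ₂ ∧ μ = μ₁ + μ₂ ∧
      μ₁ ≤ volume ∧ μ₂.real Set.univ < 1 := by
  set w := μ.rnDeriv volume with hw
  have hwm : Measurable w := Measure.measurable_rnDeriv _ _
  have hμw : volume.withDensity w = μ := Measure.withDensity_rnDeriv_eq μ volume hμ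
  set μ₁ : Measure E := volume.withDensity (fun x => min (w x) 1) with hμ₁
  set μ₂ : Measure E := volume.withDensity (fun x => w x - min (w x) 1) with hμ₂
  have hadd : μ = μ₁ + μ₂ := by
    rw [hμ₁, hμ₂, ← withDensity_add_left (by fun_prop), ← hμw]
    congr 1
    ext x
    exact (add_tsub_cancel_of_le (min_le_left _ _)).symm
  have h1 : IsFiniteMeasure μ₁ := isFiniteMeasure_of_le μ (by rw [hadd]; exact Measure.le_add_right le_rfl)
  have h2 : IsFiniteMeasure μ₂ := isFiniteMeasure_of_le μ (by rw [hadd]; exact Measure.le_add_left le_rfl)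
  refine ⟨μ₁, μ₂, h1, h2, hadd, ?_, ?_⟩
  · calc μ₁ ≤ volume.withDensity 1 := withDensity_mono (Eventually.of_forall fun x => min_le_right _ _)
      _ = volume := withDensity_one
  · have hsum : μ₁.real Set.univ + μ₂.real Set.univ = 1 := by
      rw [← measureReal_add_apply, ← hadd, probReal_univ]
    have hpos : 0 < μ₁.real Set.univ := by
      refine lt_of_le_of_ne measureReal_nonneg fun h => ?_
      have h0 : μ₁ = 0 := by
        rw [← Measure.measure_univ_eq_zero]
        exact ((measureReal_eq_zero_iff).1 h.symm)
      rw [hμ₁, withDensity_eq_zero_iff (by fun_prop)] at h0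
      have hw0 : w =ᵐ[volume] 0 := by
        filter_upwards [h0] with x hx
        rcases min_eq_iff.1 (show min (w x) 1 = 0 from hx) with h | h
        · exact h.1
        · exact absurd h.1 one_ne_zero
      have : μ = 0 := by rw [← hμw, withDensity_congr_ae hw0, withDensity_zero]
      exact IsProbabilityMeasure.ne_zero μ this
    linarith

/-- The bound on the density of `μ` is translation invariant, so averaging over translates only
costs the mass of `ν`. -/
lemma lintegral_conv_le_of_le_volume (μ ν : Measure E) [IsFiniteMeasure μ] [IsFiniteMeasure ν]
    (hμ : μ ≤ volume) {f : E → ENNReal} (hf : Measurable f) :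
    ∫⁻ x, f x ∂(μ ∗ ν) ≤ ν Set.univ * ∫⁻ x, f x := by
  rw [Measure.conv_comm, Measure.lintegral_conv hf]
  calc ∫⁻ y, ∫⁻ x, f (y + x) ∂μ ∂ν ≤ ∫⁻ y, (∫⁻ x, f x) ∂ν := by
        refine lintegral_mono fun y => ?_
        calc ∫⁻ x, f (y + x) ∂μ ≤ ∫⁻ x, f (y + x) := lintegral_mono' hμ le_rfl
          _ = ∫⁻ x, f x := lintegral_add_left_eq_self f y
    _ = ν Set.univ * ∫⁻ x, f x := by rw [lintegral_const, mul_comm]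

/-- The characteristic function of a finite measure with bounded density is square integrable. -/
lemma integrable_sq_norm_charFun (μ : Measure E) [IsFiniteMeasure μ] (hμ : μ ≤ volume) :
    Integrable fun ξ : E => ‖charFun μ ξ‖ ^ 2 := by
  suffices h : Integrable fun η : E => ‖charFun μ ((2 * Real.pi) • η)‖ ^ 2 from
    (integrable_comp_smul_iff volume (fun ξ : E => ‖charFun μ ξ‖ ^ 2) (by positivity)).1 h
  -- Symmetrization: the characteristic function of `ρ` is `‖charFun μ‖²`, which is nonnegative.
  set ρ : Measure E := μ ∗ μ.map (fun x => (-1 : ℝ) • x) with hρ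
  have hρc : ∀ ξ : E, charFun ρ ξ = ((‖charFun μ ξ‖ ^ 2 : ℝ) : ℂ) := by
    intro ξ
    rw [hρ, charFun_conv, charFun_map_smul, neg_one_smul, charFun_neg, mul_conj,
      normSq_eq_norm_sq]
  have hmeas : Measurable fun η : E => ‖charFun μ ((2 * Real.pi) • η)‖ ^ 2 :=
    ((measurable_charFun.comp (by fun_prop : Measurable fun η : E => (2 * Real.pi) • η)).norm).pow_const 2
  -- By `integral_gaussKernel_sub` at the origin, this weighted integral is the `ρ`-mean of a
  -- Gaussian of mass one. The density bound on `ρ` controls it independently of `c`, and Fatou's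
  -- lemma removes the weight.
  have hbound : ∀ c : ℝ, 0 < c → ∫⁻ η : E, ENNReal.ofReal
      (Real.exp (-(c⁻¹) * ‖η‖ ^ 2) * ‖charFun μ ((2 * Real.pi) • η)‖ ^ 2) ≤ μ Set.univ := by
    intro c hc
    have hi : Integrable fun η : E =>
        Real.exp (-(c⁻¹) * ‖η‖ ^ 2) * ‖charFun μ ((2 * Real.pi) • η)‖ ^ 2 := by
      have h1 : Integrable (fun η : E => Real.exp (-(c⁻¹) * ‖η‖ ^ 2)) := by
        have := GaussianFourier.integrable_cexp_neg_mul_sq_norm_add (b := ((c⁻¹ : ℝ) : ℂ))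
          (by simpa using hc) 0 (0 : E)
        refine this.norm.congr (Eventually.of_forall fun η => ?_)
        simp only [norm_exp]
        congr 1
        norm_cast
        simp
      refine h1.mul_bdd (c := (μ.real Set.univ) ^ 2) hmeas.aestronglyMeasurable
        (Eventually.of_forall fun η => ?_)
      rw [norm_pow, norm_norm]
      gcongr
      exact norm_charFun_le _
    rw [← ofReal_integral_eq_lintegral_ofReal hi (Eventually.of_forall fun η => by positivity)]
    have key := integral_gaussKernel_sub ρ hc 0
    have e1 : (∫ η : E, cexp (-(c⁻¹ : ℝ) * ‖η‖ ^ 2) *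
        (cexp (-⟪(0 : E), (2 * Real.pi) • η⟫ * I) * charFun ρ ((2 * Real.pi) • η))) =
        ((∫ η : E, Real.exp (-(c⁻¹) * ‖η‖ ^ 2) * ‖charFun μ ((2 * Real.pi) • η)‖ ^ 2 : ℝ) : ℂ) := by
      rw [← integral_complex_ofReal]
      congr with η
      rw [hρc]
      simp
    rw [e1] at key
    simp only [sub_zero] at key
    have hnn : 0 ≤ ∫ η : E, Real.exp (-(c⁻¹) * ‖η‖ ^ 2) * ‖charFun μ ((2 * Real.pi) • η)‖ ^ 2 :=
      integral_nonneg fun η => by positivity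
    have h3 : ENNReal.ofReal
        (∫ η : E, Real.exp (-(c⁻¹) * ‖η‖ ^ 2) * ‖charFun μ ((2 * Real.pi) • η)‖ ^ 2) =
        ‖∫ v, gaussKernel E c v ∂ρ‖ₑ := by
      rw [key, ← ofReal_norm, norm_real, Real.norm_of_nonneg hnn]
    rw [h3]
    have hg := continuous_gaussKernel (E := E) c
    calc ‖∫ v, gaussKernel E c v ∂ρ‖ₑ ≤ ∫⁻ v, ‖gaussKernel E c v‖ₑ ∂ρ :=
          enorm_integral_le_lintegral_enorm _
      _ ≤ (μ.map (fun x => (-1 : ℝ) • x)) Set.univ * ∫⁻ v, ‖gaussKernel E c v‖ₑ :=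
          lintegral_conv_le_of_le_volume _ _ hμ hg.measurable.enorm
      _ = μ Set.univ := by
          rw [Measure.map_apply (by fun_prop) MeasurableSet.univ, Set.preimage_univ,
            ← ofReal_integral_norm_eq_lintegral_enorm (integrable_gaussKernel hc),
            integral_norm_gaussKernel hc, ENNReal.ofReal_one, mul_one]
  refine ⟨hmeas.aestronglyMeasurable, ?_⟩
  rw [hasFiniteIntegral_iff_ofReal (Eventually.of_forall fun η => by positivity)]
  have hlim : ∀ η : E, Tendsto (fun n : ℕ => ENNReal.ofReal
      (Real.exp (-(((n : ℝ) + 1)⁻¹) * ‖η‖ ^ 2) * ‖charFun μ ((2 * Real.pi) • η)‖ ^ 2)) atTop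
      (𝓝 (ENNReal.ofReal (‖charFun μ ((2 * Real.pi) • η)‖ ^ 2))) := by
    intro η
    refine ENNReal.tendsto_ofReal ?_
    have h1 : Tendsto (fun n : ℕ => ((n : ℝ) + 1)⁻¹) atTop (𝓝 0) := by
      simpa using tendsto_one_div_add_atTop_nhds_zero_nat (𝕜 := ℝ)
    have h2 := ((Real.continuous_exp.tendsto _).comp (h1.neg.mul_const (‖η‖ ^ 2))).mul_const
      (‖charFun μ ((2 * Real.pi) • η)‖ ^ 2)
    simpa using h2
  calc ∫⁻ η : E, ENNReal.ofReal (‖charFun μ ((2 * Real.pi) • η)‖ ^ 2)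
      = ∫⁻ η : E, liminf (fun n : ℕ => ENNReal.ofReal
        (Real.exp (-(((n : ℝ) + 1)⁻¹) * ‖η‖ ^ 2) * ‖charFun μ ((2 * Real.pi) • η)‖ ^ 2)) atTop := by
        congr with η
        exact (hlim η).liminf_eq.symm
    _ ≤ liminf (fun n : ℕ => ∫⁻ η : E, ENNReal.ofReal
        (Real.exp (-(((n : ℝ) + 1)⁻¹) * ‖η‖ ^ 2) * ‖charFun μ ((2 * Real.pi) • η)‖ ^ 2)) atTop :=
        lintegral_liminf_le fun n => by fun_prop
    _ ≤ μ Set.univ := by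
        refine liminf_le_of_le (by isBoundedDefault) fun b hb => ?_
        obtain ⟨n, hn⟩ := hb.exists
        exact hn.trans (hbound _ (by positivity))
    _ < ⊤ := measure_lt_top _ _

/-- Riemann–Lebesgue lemma for characteristic functions. -/
lemma tendsto_charFun_cocompact (μ : Measure E) [IsFiniteMeasure μ] (hμ : μ ≪ volume) :
    Tendsto (charFun μ) (cocompact E) (𝓝 0) := by
  have h := tendsto_integral_exp_inner_smul_cocompact
    (fun x : E => (((μ.rnDeriv volume x).toReal : ℝ) : ℂ))
  have h2π : (-(2 * Real.pi)⁻¹ : ℝ) ≠ 0 := by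
    have := Real.pi_pos
    simp [this.ne']
  have hs : Tendsto (fun ξ : E => (-(2 * Real.pi)⁻¹ : ℝ) • ξ) (cocompact E) (cocompact E) :=
    (Homeomorph.smulOfNeZero _ h2π).isClosedEmbedding.tendsto_cocompact
  refine (h.comp hs).congr fun ξ => ?_
  conv_rhs => rw [charFun_apply, ← Measure.withDensity_rnDeriv_eq μ volume hμ]
  rw [integral_withDensity_eq_integral_toReal_smul (Measure.measurable_rnDeriv _ _)
    (Measure.rnDeriv_lt_top _ _)]
  simp only [Function.comp]
  congr with x
  rw [Circle.smul_def, Real.fourierChar_apply, smul_eq_mul, real_smul, mul_comm, inner_smul_right]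
  congr 2
  have := Real.pi_pos
  push_cast
  field_simp

/-- In the equality case `x ↦ exp (i⟪x, ξ⟫)` is almost surely constant, so the characteristic
function has modulus `1` at every multiple `k • ξ`, contradicting Riemann–Lebesgue. -/
lemma norm_charFun_lt_one (μ : Measure E) [IsProbabilityMeasure μ] (hμ : μ ≪ volume) {ξ : E}
    (hξ : ξ ≠ 0) : ‖charFun μ ξ‖ < 1 := by
  have h1 : ∀ᵐ x ∂μ, ‖cexp (⟪x, ξ⟫ * I)‖ ≤ 1 :=
    Eventually.of_forall fun x => (norm_exp_ofReal_mul_I _).le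
  rcases ae_eq_const_or_norm_integral_lt_of_norm_le_const h1 with h | h
  · exfalso
    obtain ⟨z, hz⟩ : ∃ z : ℂ, ∀ᵐ x ∂μ, cexp (⟪x, ξ⟫ * I) = z := ⟨_, h⟩
    have hz1 : ‖z‖ = 1 := by
      obtain ⟨x, hx⟩ := hz.exists
      rw [← hx, norm_exp_ofReal_mul_I]
    have hk : ∀ k : ℕ, ‖charFun μ ((k : ℝ) • ξ)‖ = 1 := by
      intro k
      have : charFun μ ((k : ℝ) • ξ) = z ^ k := by
        rw [charFun_apply]
        have : ∀ᵐ x ∂μ, cexp (⟪x, (k : ℝ) • ξ⟫ * I) = z ^ k := by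
          filter_upwards [hz] with x hx
          rw [← hx, ← Complex.exp_nat_mul, inner_smul_right]
          push_cast
          ring_nf
        rw [integral_congr_ae this]
        simp
      rw [this, norm_pow, hz1, one_pow]
    have ht : Tendsto (fun k : ℕ => (k : ℝ) • ξ) atTop (cocompact E) := by
      rw [← Metric.cobounded_eq_cocompact, ← tendsto_norm_atTop_iff_cobounded]
      simp_rw [norm_smul]
      simp only [RCLike.norm_natCast]
      exact tendsto_natCast_atTop_atTop.atTop_mul_const (norm_pos_iff.2 hξ)
    have := ((tendsto_charFun_cocompact μ hμ).comp ht).norm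
    simp only [Function.comp_def, hk, norm_zero] at this
    exact one_ne_zero (tendsto_nhds_unique tendsto_const_nhds this)
  · simpa [charFun_apply] using h

/-- Away from the origin the characteristic function of an absolutely continuous probability
measure is bounded away from `1`. -/
lemma exists_norm_charFun_le (μ : Measure E) [IsProbabilityMeasure μ] (hμ : μ ≪ volume) {δ : ℝ}
    (hδ : 0 < δ) : ∃ r < 1, 0 ≤ r ∧ ∀ ξ : E, δ ≤ ‖ξ‖ → ‖charFun μ ξ‖ ≤ r := by
  have hlim := (tendsto_charFun_cocompact μ hμ).norm
  rw [norm_zero, ← Metric.cobounded_eq_cocompact] at hlim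
  have hev := hlim.eventually (ge_mem_nhds (show (0 : ℝ) < 1 / 2 by norm_num))
  obtain ⟨R, -, hR⟩ := (hasBasis_cobounded_norm (E := E)).eventually_iff.1 hev
  -- Riemann–Lebesgue gives the bound `1 / 2` beyond radius `R`; on the remaining compact shell the
  -- maximum is attained and is below `1`.
  have hK : IsCompact (Metric.closedBall (0 : E) R \ Metric.ball 0 δ) :=
    (isCompact_closedBall _ _).diff Metric.isOpen_ball
  obtain ⟨r, hr1, hr⟩ : ∃ r < 1, ∀ ξ ∈ Metric.closedBall (0 : E) R \ Metric.ball 0 δ,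
      ‖charFun μ ξ‖ ≤ r := by
    rcases (Metric.closedBall (0 : E) R \ Metric.ball 0 δ).eq_empty_or_nonempty with h | h
    · exact ⟨0, one_pos, by simp [h]⟩
    · obtain ⟨ξ₀, hξ₀, hmax⟩ := hK.exists_isMaxOn h
        (continuous_charFun (μ := μ)).norm.continuousOn
      refine ⟨_, norm_charFun_lt_one μ hμ (ξ := ξ₀) ?_, fun ξ hξ => hmax hξ⟩
      rintro rfl
      exact hξ₀.2 (Metric.mem_ball_self hδ)
  refine ⟨max r (1 / 2), max_lt hr1 (by norm_num), le_max_of_le_right (by norm_num),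
    fun ξ hξ => ?_⟩
  by_cases h : R ≤ ‖ξ‖
  · exact (hR h).trans (le_max_right _ _)
  · refine (hr ξ ⟨?_, ?_⟩).trans (le_max_left _ _)
    · simpa using (not_le.1 h).le
    · simpa using hξ

end CharFunAbsolutelyContinuous

/-! ### Convolution powers and their characteristic functions. -/

section LocalLimit

open Filter Topology Complex Module Asymptotics
open scoped RealInnerProductSpace

variable {E : Type*} [NormedAddCommGroup E] [InnerProductSpace ℝ E] [FiniteDimensional ℝ E]
  [MeasurableSpace E] [BorelSpace E]

/-- Convolution powers of a measure. -/
noncomputable def convPow (μ : Measure E) : ℕ → Measure E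
  | 0 => Measure.dirac 0
  | n + 1 => μ ∗ convPow μ n

instance isFiniteMeasure_convPow (μ : Measure E) [IsFiniteMeasure μ] (n : ℕ) :
    IsFiniteMeasure (convPow μ n) := by
  induction n with
  | zero => rw [convPow]; infer_instance
  | succ n ih => rw [convPow]; infer_instance

instance isProbabilityMeasure_convPow (μ : Measure E) [IsProbabilityMeasure μ] (n : ℕ) :
    IsProbabilityMeasure (convPow μ n) := by
  induction n with
  | zero => rw [convPow]; infer_instance
  | succ n ih => rw [convPow]; infer_instance

lemma charFun_convPow (μ : Measure E) [IsFiniteMeasure μ] (n : ℕ) (ξ : E) :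
    charFun (convPow μ n) ξ = charFun μ ξ ^ n := by
  induction n with
  | zero => simp [convPow, charFun_dirac]
  | succ n ih => rw [convPow, charFun_conv, ih, pow_succ']

/-- The part of the convolution power `(μ₁ + μ₂)ⁿ` that has at least two factors `μ₁`. -/
noncomputable def convPowTwo (μ₁ μ₂ : Measure E) : ℕ → Measure E
  | 0 => 0
  | n + 1 => (μ₁ + μ₂) ∗ convPowTwo μ₁ μ₂ n +
      (n : NNReal) • ((μ₁ ∗ μ₁) ∗ convPow μ₂ (n - 1))

variable (μ₁ μ₂ : Measure E) [IsFiniteMeasure μ₁] [IsFiniteMeasure μ₂]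

instance isFiniteMeasure_convPowTwo (n : ℕ) : IsFiniteMeasure (convPowTwo μ₁ μ₂ n) := by
  induction n with
  | zero => rw [convPowTwo]; infer_instance
  | succ n ih => rw [convPowTwo]; infer_instance

lemma charFun_nnreal_smul_measure (c : NNReal) (μ : Measure E) (ξ : E) :
    charFun (c • μ) ξ = (c : ℝ) * charFun μ ξ := by
  rw [charFun_apply, integral_smul_nnreal_measure]
  simp [charFun_apply, NNReal.smul_def]

/-- The last term counts products in which the new factor is the second `μ₁`: the earlier one may
sit in any of `n` places. At `n = 0` the truncated `n - 1` is harmless because the coefficient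
vanishes. -/
lemma charFun_convPowTwo_succ (n : ℕ) (ξ : E) :
    charFun (convPowTwo μ₁ μ₂ (n + 1)) ξ = (charFun μ₁ ξ + charFun μ₂ ξ) *
      charFun (convPowTwo μ₁ μ₂ n) ξ + n * (charFun μ₁ ξ ^ 2 * charFun μ₂ ξ ^ (n - 1)) := by
  rw [convPowTwo, charFun_add_measure, charFun_conv, charFun_add_measure,
    charFun_nnreal_smul_measure, charFun_conv, charFun_conv, charFun_convPow]
  push_cast
  ring

/-- The subtracted terms are the products with no factor `μ₁` and with exactly one. -/
lemma charFun_convPowTwo (n : ℕ) (ξ : E) :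
    charFun (convPowTwo μ₁ μ₂ n) ξ = (charFun μ₁ ξ + charFun μ₂ ξ) ^ n - charFun μ₂ ξ ^ n -
      n * (charFun μ₁ ξ * charFun μ₂ ξ ^ (n - 1)) := by
  induction n with
  | zero => simp [convPowTwo]
  | succ n ih =>
    rw [charFun_convPowTwo_succ, ih]
    rcases n with _ | n
    · simp
    · simp only [Nat.add_sub_cancel]
      push_cast
      ring

/-- Two factors `μ₁` supply the integrable `‖charFun μ₁‖²`, the other `n` supply geometric decay.
The crude count `(n + 2)²` is closed under the recursion since `m² + m ≤ (m + 1)²`. -/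
lemma norm_charFun_convPowTwo_le {ρ : ℝ} {ξ : E} (h : ‖charFun μ₁ ξ + charFun μ₂ ξ‖ ≤ ρ)
    (h₂ : ‖charFun μ₂ ξ‖ ≤ ρ) (n : ℕ) :
    ‖charFun (convPowTwo μ₁ μ₂ (n + 2)) ξ‖ ≤ (n + 2) ^ 2 * ρ ^ n * ‖charFun μ₁ ξ‖ ^ 2 := by
  have hρ : 0 ≤ ρ := (norm_nonneg _).trans h₂
  induction n with
  | zero =>
    have : charFun (convPowTwo μ₁ μ₂ (0 + 2)) ξ = charFun μ₁ ξ ^ 2 := by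
      rw [charFun_convPowTwo]; simp; ring
    rw [this, norm_pow]
    have := sq_nonneg ‖charFun μ₁ ξ‖
    norm_num
    linarith
  | succ n ih =>
    rw [charFun_convPowTwo_succ]
    calc _ ≤ ρ * ((n + 2) ^ 2 * ρ ^ n * ‖charFun μ₁ ξ‖ ^ 2) +
          (n + 2) * (‖charFun μ₁ ξ‖ ^ 2 * ρ ^ (n + 1)) := by
          refine (norm_add_le _ _).trans (add_le_add ?_ ?_)
          · rw [norm_mul]
            exact mul_le_mul h ih (norm_nonneg _) hρ
          · rw [norm_mul, norm_mul, norm_pow, norm_pow]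
            have : ‖((n + 2 : ℕ) : ℂ)‖ = n + 2 := by
              rw [Complex.norm_natCast]; push_cast; ring
            rw [this]
            exact mul_le_mul_of_nonneg_left (mul_le_mul_of_nonneg_left
              (pow_le_pow_left₀ (norm_nonneg _) h₂ _) (by positivity)) (by positivity)
      _ = ((n + 2) ^ 2 + (n + 2)) * (ρ ^ (n + 1) * ‖charFun μ₁ ξ‖ ^ 2) := by ring
      _ ≤ ((n + 1 : ℕ) + 2) ^ 2 * (ρ ^ (n + 1) * ‖charFun μ₁ ξ‖ ^ 2) := by
          gcongr
          push_cast
          nlinarith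
      _ = _ := by ring

/-- The omitted terms are characteristic functions of positive measures, so uniqueness turns the
identity of transforms into a decomposition of the full power. -/
lemma convPowTwo_le_convPow (n : ℕ) : convPowTwo μ₁ μ₂ n ≤ convPow (μ₁ + μ₂) n := by
  have : convPow (μ₁ + μ₂) n = convPowTwo μ₁ μ₂ n +
      (convPow μ₂ n + (n : NNReal) • (μ₁ ∗ convPow μ₂ (n - 1))) := by
    refine Measure.ext_of_charFun (funext fun ξ => ?_)
    rw [charFun_add_measure, charFun_add_measure, charFun_nnreal_smul_measure, charFun_conv,
      charFun_convPow, charFun_convPow, charFun_convPow, charFun_add_measure, charFun_convPowTwo]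
    push_cast
    ring
  rw [this]
  exact Measure.le_add_right le_rfl

/-- Near the origin the remainder costs at most half of the quadratic decay. This Gaussian bound is
what dominates the low frequencies. -/
lemma norm_charFun_le_exp_of_isLittleO {μ : Measure E} {a : ℝ} (ha : 0 < a)
    (hμ : (fun ξ : E => charFun μ ξ - (1 - a * ‖ξ‖ ^ 2 : ℝ)) =o[𝓝 0] fun ξ => ‖ξ‖ ^ 2) :
    ∃ δ > 0, ∀ ξ : E, ‖ξ‖ < δ → ‖charFun μ ξ‖ ≤ Real.exp (-(a / 2) * ‖ξ‖ ^ 2) := by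
  obtain ⟨δ, hδ, h⟩ := Metric.eventually_nhds_iff.1 (hμ.def (half_pos ha))
  -- The radius `√a⁻¹` keeps `1 - a‖ξ‖²` nonnegative, so it equals its norm.
  refine ⟨min δ (Real.sqrt a⁻¹), by positivity, fun ξ hξ => ?_⟩
  have h1 := h (y := ξ) (by simpa using hξ.trans_le (min_le_left _ _))
  have h2 : a * ‖ξ‖ ^ 2 ≤ 1 := by
    have h3 : ‖ξ‖ ^ 2 ≤ a⁻¹ :=
      (Real.le_sqrt (norm_nonneg _) (by positivity)).1 (hξ.le.trans (min_le_right _ _))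
    calc a * ‖ξ‖ ^ 2 ≤ a * a⁻¹ := by gcongr
      _ = 1 := mul_inv_cancel₀ ha.ne'
  rw [norm_pow, norm_norm] at h1
  calc ‖charFun μ ξ‖ = ‖(charFun μ ξ - (1 - a * ‖ξ‖ ^ 2 : ℝ)) + (1 - a * ‖ξ‖ ^ 2 : ℝ)‖ := by simp
    _ ≤ a / 2 * ‖ξ‖ ^ 2 + (1 - a * ‖ξ‖ ^ 2) := by
        refine (norm_add_le _ _).trans (add_le_add h1 ?_)
        rw [norm_real, Real.norm_of_nonneg (by linarith)]
    _ = -(a / 2) * ‖ξ‖ ^ 2 + 1 := by ring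
    _ ≤ _ := Real.add_one_le_exp _

/-- Pointwise convergence of characteristic functions in the central limit theorem. -/
lemma tendsto_charFun_pow_of_isLittleO {μ : Measure E} {a : ℝ}
    (hμ : (fun ξ : E => charFun μ ξ - (1 - a * ‖ξ‖ ^ 2 : ℝ)) =o[𝓝 0] fun ξ => ‖ξ‖ ^ 2) (ξ : E) :
    Tendsto (fun n : ℕ => charFun μ ((√n)⁻¹ • ξ) ^ n) atTop
      (𝓝 (cexp ((-a * ‖ξ‖ ^ 2 : ℝ) : ℂ))) := by
  have hs : Tendsto (fun n : ℕ => (√n)⁻¹ • ξ) atTop (𝓝 0) := by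
    have h1 : Tendsto (fun n : ℕ => (√(n : ℝ))⁻¹) atTop (𝓝 0) :=
      (Real.tendsto_sqrt_atTop.comp tendsto_natCast_atTop_atTop).inv_tendsto_atTop
    simpa using h1.smul_const ξ
  have hn : ∀ n : ℕ, n ≠ 0 → ‖(√(n : ℝ))⁻¹ • ξ‖ ^ 2 = (n : ℝ)⁻¹ * ‖ξ‖ ^ 2 := by
    intro n hn
    rw [norm_smul, mul_pow, norm_inv, inv_pow, Real.norm_of_nonneg (Real.sqrt_nonneg _),
      Real.sq_sqrt (Nat.cast_nonneg _)]
  have ho := (hμ.comp_tendsto hs)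
  have h0 : Tendsto (fun n : ℕ => (n : ℂ) * (charFun μ ((√n)⁻¹ • ξ) -
      (1 - a * ‖(√n)⁻¹ • ξ‖ ^ 2 : ℝ))) atTop (𝓝 0) := by
    have h1 : (fun n : ℕ => (n : ℂ)) =O[atTop] fun n : ℕ => (n : ℝ) :=
      IsBigO.of_bound 1 (Eventually.of_forall fun n => by simp)
    refine (isLittleO_one_iff ℝ).1 ((h1.mul_isLittleO ho).trans_isBigO ?_)
    refine IsBigO.of_bound (‖ξ‖ ^ 2) ?_
    filter_upwards [eventually_ne_atTop 0] with n hn0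
    simp only [Function.comp]
    rw [hn n hn0, ← mul_assoc, mul_inv_cancel₀ (by exact_mod_cast hn0), one_mul, norm_one, mul_one,
      Real.norm_of_nonneg (by positivity)]
  have hlim : Tendsto (fun n : ℕ => (n : ℂ) * (charFun μ ((√n)⁻¹ • ξ) - 1)) atTop
      (𝓝 ((-a * ‖ξ‖ ^ 2 : ℝ) : ℂ)) := by
    have h4 := h0.add_const ((-a * ‖ξ‖ ^ 2 : ℝ) : ℂ)
    rw [zero_add] at h4
    refine h4.congr' ?_
    filter_upwards [eventually_ne_atTop 0] with n hn0
    rw [hn n hn0]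
    have : (n : ℂ) ≠ 0 := by exact_mod_cast hn0
    push_cast
    field_simp
    ring
  have := Complex.tendsto_one_add_pow_exp_of_tendsto hlim
  simpa using this

end LocalLimit

/-! ### The local limit theorem as a lower bound. -/

section LocalLimitTheorem

open Filter Topology Complex Module Asymptotics
open scoped RealInnerProductSpace

variable {E : Type*} [NormedAddCommGroup E] [InnerProductSpace ℝ E] [FiniteDimensional ℝ E]
  [MeasurableSpace E] [BorelSpace E]

lemma integrable_exp_neg_mul_sq_norm {b : ℝ} (hb : 0 < b) :
    Integrable fun ξ : E => Real.exp (-b * ‖ξ‖ ^ 2) := by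
  have := GaussianFourier.integrable_cexp_neg_mul_sq_norm_add (b := (b : ℂ))
    (by simpa using hb) 0 (0 : E)
  refine this.norm.congr (Eventually.of_forall fun η => ?_)
  simp only [norm_exp]
  congr 1
  norm_cast
  simp

lemma norm_ball_indicator_smul {δ : ℝ} {n : ℕ} (hn : n ≠ 0) (ξ : E) :
    (√(n : ℝ))⁻¹ • ξ ∈ Metric.ball (0 : E) δ ↔ ‖ξ‖ < δ * √n := by
  have : 0 < √(n : ℝ) := Real.sqrt_pos.2 (by positivity)
  rw [mem_ball_zero_iff, norm_smul, norm_inv, Real.norm_of_nonneg this.le, inv_mul_lt_iff₀ this,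
    mul_comm]

/-- The low frequency part of the characteristic functions in the central limit theorem converges
in `L¹`. -/
lemma tendsto_integral_norm_indicator_charFun_pow_sub {μ : Measure E} [IsFiniteMeasure μ] {a δ : ℝ}
    (ha : 0 < a) (hδ : 0 < δ)
    (hμ : (fun ξ : E => charFun μ ξ - (1 - a * ‖ξ‖ ^ 2 : ℝ)) =o[𝓝 0] fun ξ => ‖ξ‖ ^ 2)
    (hμδ : ∀ ξ : E, ‖ξ‖ < δ → ‖charFun μ ξ‖ ≤ Real.exp (-(a / 2) * ‖ξ‖ ^ 2)) :
    Tendsto (fun n : ℕ => ∫ ξ : E, ‖(Metric.ball (0 : E) δ).indicator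
      (fun η => charFun μ η ^ n) ((√n)⁻¹ • ξ) - cexp ((-a * ‖ξ‖ ^ 2 : ℝ) : ℂ)‖) atTop (𝓝 0) := by
  have h0 : (0 : ℝ) = ∫ _ : E, (0 : ℝ) := by simp
  rw [h0]
  have hcm := measurable_charFun (μ := μ)
  -- The Gaussian bound is invariant under `n`-th power and scaling by `1 / √n`, so one dominating
  -- function serves all `n`; the ball indicator is eventually `1` at each `ξ`.
  refine tendsto_integral_filter_of_dominated_convergence
    (fun ξ => Real.exp (-(a / 2) * ‖ξ‖ ^ 2) + Real.exp (-a * ‖ξ‖ ^ 2)) ?_ ?_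
    ((integrable_exp_neg_mul_sq_norm (by positivity)).add (integrable_exp_neg_mul_sq_norm ha)) ?_
  · refine Eventually.of_forall fun n => Measurable.aestronglyMeasurable ?_
    refine Measurable.norm (Measurable.sub ?_ (by fun_prop))
    exact ((hcm.pow_const n).indicator Metric.isOpen_ball.measurableSet).comp (by fun_prop)
  · filter_upwards [eventually_ne_atTop 0] with n hn
    refine Eventually.of_forall fun ξ => ?_
    rw [norm_norm]
    refine (norm_sub_le _ _).trans (add_le_add ?_ ?_)
    · by_cases h : (√(n : ℝ))⁻¹ • ξ ∈ Metric.ball (0 : E) δ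
      · rw [Set.indicator_of_mem h, norm_pow]
        calc _ ≤ Real.exp (-(a / 2) * ‖(√(n : ℝ))⁻¹ • ξ‖ ^ 2) ^ n := by
              gcongr
              exact hμδ _ (by simpa using h)
          _ = _ := by
              rw [← Real.exp_nat_mul, norm_smul, mul_pow, norm_inv, inv_pow,
                Real.norm_of_nonneg (Real.sqrt_nonneg _), Real.sq_sqrt (Nat.cast_nonneg _)]
              congr 1
              have : (n : ℝ) ≠ 0 := by exact_mod_cast hn
              field_simp
      · rw [Set.indicator_of_notMem h, norm_zero]
        positivity
    · rw [← ofReal_exp, norm_real, Real.norm_of_nonneg (Real.exp_pos _).le]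
  · refine Eventually.of_forall fun ξ => ?_
    have h1 := ((tendsto_charFun_pow_of_isLittleO hμ ξ).sub_const
      (cexp ((-a * ‖ξ‖ ^ 2 : ℝ) : ℂ))).norm
    rw [sub_self, norm_zero] at h1
    refine h1.congr' ?_
    have h2 : Tendsto (fun n : ℕ => δ * √(n : ℝ)) atTop atTop :=
      (Real.tendsto_sqrt_atTop.comp tendsto_natCast_atTop_atTop).const_mul_atTop hδ
    filter_upwards [h2.eventually_gt_atTop ‖ξ‖, eventually_ne_atTop 0] with n hn hn0
    rw [Set.indicator_of_mem ((norm_ball_indicator_smul hn0 ξ).2 hn)]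

/-- The remaining part of the characteristic functions is negligible in `L¹`. -/
lemma tendsto_integral_norm_charFun_convPowTwo_sub_indicator (μ₁ μ₂ : Measure E)
    [IsFiniteMeasure μ₁] [IsFiniteMeasure μ₂] [IsProbabilityMeasure (μ₁ + μ₂)]
    (hac : μ₁ + μ₂ ≪ volume) (hμ₁ : μ₁ ≤ volume) (hμ₂ : μ₂.real Set.univ < 1)
    {δ : ℝ} (hδ : 0 < δ) :
    Tendsto (fun n : ℕ => ∫ ξ : E, ‖charFun (convPowTwo μ₁ μ₂ n) ((√n)⁻¹ • ξ) -
      (Metric.ball (0 : E) δ).indicator (fun η => charFun (μ₁ + μ₂) η ^ n) ((√n)⁻¹ • ξ)‖) atTop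
      (𝓝 0) := by
  obtain ⟨r, hr1, hr0, hr⟩ := exists_norm_charFun_le (μ₁ + μ₂) hac hδ
  -- One rate for both `charFun μ₂` everywhere and `charFun (μ₁ + μ₂)` off the ball; the `1 / 2`
  -- only makes it positive, hence invertible.
  set ρ : ℝ := max (max r (μ₂.real Set.univ)) (1 / 2) with hρ
  have hρ0 : 0 < ρ := lt_of_lt_of_le (by norm_num) (le_max_right _ _)
  have hρ1 : ρ < 1 := max_lt (max_lt hr1 hμ₂) (by norm_num)
  have h2ρ : ∀ ξ : E, ‖charFun μ₂ ξ‖ ≤ ρ := fun ξ =>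
    (norm_charFun_le ξ).trans ((le_max_right _ _).trans (le_max_left _ _))
  have h1one : ∀ ξ : E, ‖charFun μ₁ ξ‖ ≤ 1 := fun ξ => by
    refine (norm_charFun_le ξ).trans ?_
    have : μ₁.real Set.univ + μ₂.real Set.univ = 1 := by
      rw [← measureReal_add_apply, probReal_univ]
    have := measureReal_nonneg (μ := μ₂) (s := Set.univ)
    linarith
  set B : E → ℝ := (Metric.ball (0 : E) δ).indicator 1 with hB
  have hBi : Integrable B := by
    refine (integrable_indicator_iff Metric.isOpen_ball.measurableSet).2 ?_
    exact integrableOn_const (C := (1 : ℝ)) (measure_ball_lt_top.ne)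
  -- `B` covers the terms dropped inside the ball, `‖charFun μ₁‖²` what remains outside it.
  set g : E → ℝ := fun η => 2 * (B η + ‖charFun μ₁ η‖ ^ 2) with hg
  have hgi : Integrable g := (hBi.add (integrable_sq_norm_charFun μ₁ hμ₁)).const_mul 2
  have hBnn : ∀ η, 0 ≤ B η := fun η => Set.indicator_nonneg (fun _ _ => zero_le_one) η
  have hgnn : ∀ η, 0 ≤ g η := fun η => by
    have := hBnn η
    simp only [hg]
    positivity
  -- pointwise bound
  have hpt : ∀ (n : ℕ) (η : E), ‖charFun (convPowTwo μ₁ μ₂ (n + 2)) η -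
      (Metric.ball (0 : E) δ).indicator (fun η => charFun (μ₁ + μ₂) η ^ (n + 2)) η‖ ≤
      (n + 2) ^ 2 * ρ ^ n * g η := by
    intro n η
    by_cases h : η ∈ Metric.ball (0 : E) δ
    · have hBη : B η = 1 := by simp [hB, h]
      rw [Set.indicator_of_mem h, charFun_convPowTwo, charFun_add_measure]
      have e : ((charFun μ₁ η + charFun μ₂ η) ^ (n + 2) - charFun μ₂ η ^ (n + 2) -
          ((n + 2 : ℕ) : ℂ) * (charFun μ₁ η * charFun μ₂ η ^ (n + 2 - 1)) -
          (charFun μ₁ η + charFun μ₂ η) ^ (n + 2)) = -(charFun μ₂ η ^ (n + 2) +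
          ((n + 2 : ℕ) : ℂ) * (charFun μ₁ η * charFun μ₂ η ^ (n + 1))) := by
        simp only [show n + 2 - 1 = n + 1 by omega]
        ring
      rw [e, norm_neg]
      calc _ ≤ ρ ^ (n + 2) + (n + 2) * (1 * ρ ^ (n + 1)) := by
            refine (norm_add_le _ _).trans (add_le_add ?_ ?_)
            · rw [norm_pow]
              exact pow_le_pow_left₀ (norm_nonneg _) (h2ρ η) _
            · rw [norm_mul, norm_mul, norm_pow, norm_natCast]
              push_cast
              gcongr
              · exact h1one η
              · exact h2ρ η
        _ ≤ 1 * ρ ^ n + (n + 2) * (1 * ρ ^ n) := by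
            have e1 : ρ ^ (n + 2) ≤ ρ ^ n := pow_le_pow_of_le_one hρ0.le hρ1.le (by omega)
            have e2 : ρ ^ (n + 1) ≤ ρ ^ n := pow_le_pow_of_le_one hρ0.le hρ1.le (by omega)
            simp only [one_mul]
            gcongr
        _ = (n + 3) * ρ ^ n := by ring
        _ ≤ (n + 2) ^ 2 * ρ ^ n * 2 := by
            have : (n + 3 : ℝ) ≤ (n + 2) ^ 2 * 2 := by nlinarith [Nat.cast_nonneg (α := ℝ) n]
            nlinarith [pow_pos hρ0 n]
        _ ≤ (n + 2) ^ 2 * ρ ^ n * g η := by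
            gcongr
            simp only [hg, hBη]
            nlinarith [sq_nonneg ‖charFun μ₁ η‖]
    · rw [Set.indicator_of_notMem h, sub_zero]
      have hη : δ ≤ ‖η‖ := by simpa using h
      have h1ρ : ‖charFun μ₁ η + charFun μ₂ η‖ ≤ ρ := by
        rw [← charFun_add_measure]
        exact (hr η hη).trans ((le_max_left _ _).trans (le_max_left _ _))
      refine (norm_charFun_convPowTwo_le μ₁ μ₂ h1ρ (h2ρ η) n).trans ?_
      gcongr
      have := hBnn η
      simp only [hg]
      nlinarith [sq_nonneg ‖charFun μ₁ η‖]
  -- integrated bound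
  have hint : ∀ n : ℕ, ∫ ξ : E, ‖charFun (convPowTwo μ₁ μ₂ (n + 2)) ((√((n + 2 : ℕ) : ℝ))⁻¹ • ξ) -
      (Metric.ball (0 : E) δ).indicator (fun η => charFun (μ₁ + μ₂) η ^ (n + 2))
        ((√((n + 2 : ℕ) : ℝ))⁻¹ • ξ)‖ ≤
      ((n + 2 : ℕ) : ℝ) ^ (finrank ℝ E + 2) * ρ ^ (n + 2) * (ρ⁻¹ ^ 2 * ∫ η, g η) := by
    intro n
    -- Undoing the scaling costs `√n ^ d ≤ n ^ d`, with `d` the dimension, which the geometric decay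
    -- absorbs.
    rw [Measure.integral_comp_smul volume (fun η : E => ‖charFun (convPowTwo μ₁ μ₂ (n + 2)) η -
      (Metric.ball (0 : E) δ).indicator (fun η => charFun (μ₁ + μ₂) η ^ (n + 2)) η‖)]
    have hs1 : 1 ≤ √((n + 2 : ℕ) : ℝ) := by
      rw [Real.one_le_sqrt]; push_cast; linarith [Nat.cast_nonneg (α := ℝ) n]
    have hs2 : √((n + 2 : ℕ) : ℝ) ≤ ((n + 2 : ℕ) : ℝ) := by
      rw [Real.sqrt_le_left (by positivity)]
      push_cast; nlinarith [Nat.cast_nonneg (α := ℝ) n]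
    rw [inv_pow, inv_inv, abs_of_nonneg (by positivity), smul_eq_mul]
    have hb : ∫ η : E, ‖charFun (convPowTwo μ₁ μ₂ (n + 2)) η -
        (Metric.ball (0 : E) δ).indicator (fun η => charFun (μ₁ + μ₂) η ^ (n + 2)) η‖ ≤
        (n + 2) ^ 2 * ρ ^ n * ∫ η, g η := by
      rw [← integral_const_mul]
      exact integral_mono_of_nonneg (Eventually.of_forall fun η => norm_nonneg _)
        (hgi.const_mul _) (Eventually.of_forall (hpt n))
    have hg0 : 0 ≤ ∫ η, g η := integral_nonneg hgnn
    calc _ ≤ ((n + 2 : ℕ) : ℝ) ^ finrank ℝ E * ((n + 2) ^ 2 * ρ ^ n * ∫ η, g η) := by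
          gcongr
      _ = _ := by
          push_cast
          field_simp
          ring
  have hlim : Tendsto (fun n : ℕ => (n : ℝ) ^ (finrank ℝ E + 2) * ρ ^ n *
      (ρ⁻¹ ^ 2 * ∫ η, g η)) atTop (𝓝 0) := by
    have := (tendsto_pow_const_mul_const_pow_of_abs_lt_one (finrank ℝ E + 2)
      (by rwa [abs_of_pos hρ0] : |ρ| < 1)).mul_const (ρ⁻¹ ^ 2 * ∫ η, g η)
    rwa [zero_mul] at this
  refine squeeze_zero' (Eventually.of_forall fun n => integral_nonneg fun ξ => norm_nonneg _) ?_ hlim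
  filter_upwards [eventually_ge_atTop 2] with n hn
  obtain ⟨m, rfl⟩ := Nat.exists_eq_add_of_le' hn
  exact hint m

/-- The explicit limit density; its smallest value on a ball determines the constant in the local
limit theorem. -/
lemma integral_cexp_inner_mul_gaussian {a : ℝ} (ha : 0 < a) (w : E) :
    ∫ η : E, cexp (-⟪w, (2 * Real.pi) • η⟫ * I) * cexp ((-a * ‖(2 * Real.pi) • η‖ ^ 2 : ℝ) : ℂ) =
      (((Real.pi / (4 * Real.pi ^ 2 * a)) ^ (finrank ℝ E / 2 : ℝ) *
        Real.exp (-‖w‖ ^ 2 / (4 * a)) : ℝ) : ℂ) := by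
  have hb : 0 < 4 * Real.pi ^ 2 * a := by positivity
  have := GaussianFourier.integral_cexp_neg_mul_sq_norm_add (b := ((4 * Real.pi ^ 2 * a : ℝ) : ℂ))
    (by rwa [ofReal_re]) (-(2 * Real.pi * I)) w
  convert this using 2
  · ext η
    rw [← Complex.exp_add, inner_smul_right, norm_smul, mul_pow,
      Real.norm_of_nonneg (by positivity)]
    push_cast
    ring_nf
  · rw [ofReal_mul, ofReal_cpow (by positivity), ofReal_exp]
    congr 1
    · push_cast
      rfl
    · congr 1
      have : (a : ℂ) ≠ 0 := by exact_mod_cast ha.ne'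
      push_cast
      field_simp
      ring_nf
      simp

/-- **Local limit theorem, lower bound.** For an absolutely continuous probability measure `μ` with
`charFun μ ξ = 1 - a ‖ξ‖² + o(‖ξ‖²)`, the normalized convolution powers eventually dominate a
multiple of Lebesgue measure on any given ball. -/
theorem exists_smul_volume_restrict_ball_le_map_convPow (μ : Measure E) [IsProbabilityMeasure μ]
    (hac : μ ≪ volume) {a : ℝ} (ha : 0 < a)
    (hμ : (fun ξ : E => charFun μ ξ - (1 - a * ‖ξ‖ ^ 2 : ℝ)) =o[𝓝 0] fun ξ => ‖ξ‖ ^ 2)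
    (K : ℝ) :
    ∃ c > 0, ∀ᶠ n : ℕ in atTop, ENNReal.ofReal c • volume.restrict (Metric.ball (0 : E) K) ≤
      (convPow μ n).map (fun x => (√n)⁻¹ • x) := by
  obtain ⟨δ, hδ, hμδ⟩ := norm_charFun_le_exp_of_isLittleO ha hμ
  obtain ⟨μ₁, μ₂, hf₁, hf₂, rfl, hμ₁, hμ₂⟩ := exists_add_eq_and_le_volume μ hac
  -- The limit Gaussian density at distance `K` from the origin; half of it is later given up to the
  -- error.
  set c : ℝ := (Real.pi / (4 * Real.pi ^ 2 * a)) ^ (finrank ℝ E / 2 : ℝ) *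
    Real.exp (-K ^ 2 / (4 * a)) with hc
  have hc0 : 0 < c := by
    have := Real.pi_pos
    positivity
  have hki : ∀ n : ℕ, Integrable fun ξ : E => charFun (convPowTwo μ₁ μ₂ (n + 2)) ξ := by
    intro n
    refine ((integrable_sq_norm_charFun μ₁ hμ₁).const_mul ((n + 2) ^ 2 * 1 ^ n)).mono'
      measurable_charFun.aestronglyMeasurable (Eventually.of_forall fun ξ => ?_)
    refine norm_charFun_convPowTwo_le μ₁ μ₂ ?_ ?_ n
    · rw [← charFun_add_measure]
      exact norm_charFun_le_one ξ
    · exact (norm_charFun_le ξ).trans hμ₂.le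
  have hGi : Integrable fun ξ : E => cexp ((-a * ‖ξ‖ ^ 2 : ℝ) : ℂ) := by
    simpa using (integrable_exp_neg_mul_sq_norm (E := E) ha).ofReal (𝕜 := ℂ)
  have hlim : Tendsto (fun n : ℕ => ∫ ξ : E, ‖charFun (convPowTwo μ₁ μ₂ n) ((√n)⁻¹ • ξ) -
      cexp ((-a * ‖ξ‖ ^ 2 : ℝ) : ℂ)‖) atTop (𝓝 0) := by
    have h1 := tendsto_integral_norm_charFun_convPowTwo_sub_indicator μ₁ μ₂ hac hμ₁ hμ₂ hδ
    have h2 := tendsto_integral_norm_indicator_charFun_pow_sub ha hδ hμ hμδ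
    have h3 := h1.add h2
    rw [add_zero] at h3
    refine squeeze_zero' (Eventually.of_forall fun n => integral_nonneg fun ξ => norm_nonneg _) ?_ h3
    filter_upwards [eventually_ge_atTop 2] with n hn
    have hn0 : (√(n : ℝ))⁻¹ ≠ 0 := (inv_pos.2 (Real.sqrt_pos.2 (by positivity))).ne'
    have hki' : Integrable fun ξ : E => charFun (convPowTwo μ₁ μ₂ n) ((√(n : ℝ))⁻¹ • ξ) := by
      obtain ⟨m, rfl⟩ := Nat.exists_eq_add_of_le' hn
      exact (hki m).comp_smul hn0
    have hFi : Integrable fun ξ : E => (Metric.ball (0 : E) δ).indicator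
        (fun η => charFun (μ₁ + μ₂) η ^ n) ((√(n : ℝ))⁻¹ • ξ) := by
      refine Integrable.comp_smul (f := (Metric.ball (0 : E) δ).indicator
        (fun η => charFun (μ₁ + μ₂) η ^ n)) ?_ hn0
      refine (integrable_indicator_iff Metric.isOpen_ball.measurableSet).2 ?_
      refine Integrable.mono' (g := fun _ => (1 : ℝ))
        (integrableOn_const (C := (1 : ℝ)) (measure_ball_lt_top.ne))
        (measurable_charFun.pow_const n).aestronglyMeasurable (Eventually.of_forall fun ξ => ?_)
      rw [norm_pow]
      exact pow_le_one₀ (norm_nonneg _) (norm_charFun_le_one ξ)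
    refine le_of_le_of_eq ?_ (integral_add (hki'.sub hFi).norm (hFi.sub hGi).norm)
    refine integral_mono (hki'.sub hGi).norm ((hki'.sub hFi).norm.add (hFi.sub hGi).norm) fun ξ => ?_
    exact norm_sub_le_norm_sub_add_norm_sub _ _ _
  have hlim' := hlim.const_mul (|((2 * Real.pi) ^ finrank ℝ E)⁻¹|)
  rw [mul_zero] at hlim'
  refine ⟨c / 2, by positivity, ?_⟩
  filter_upwards [hlim'.eventually (ge_mem_nhds (half_pos hc0)), eventually_ge_atTop 2] with n hn hn2
  have hn0 : (√(n : ℝ))⁻¹ ≠ 0 := (inv_pos.2 (Real.sqrt_pos.2 (by positivity))).ne'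
  refine le_trans ?_ (Measure.map_mono (convPowTwo_le_convPow μ₁ μ₂ n) (by fun_prop))
  have hchar : ∀ ξ : E, charFun ((convPowTwo μ₁ μ₂ n).map (fun x => (√(n : ℝ))⁻¹ • x)) ξ =
      charFun (convPowTwo μ₁ μ₂ n) ((√(n : ℝ))⁻¹ • ξ) := fun ξ => charFun_map_smul _ _
  have hi : Integrable fun η : E =>
      charFun (convPowTwo μ₁ μ₂ n) ((√(n : ℝ))⁻¹ • ((2 * Real.pi) • η)) := by
    refine Integrable.comp_smul (f := fun ξ : E => charFun (convPowTwo μ₁ μ₂ n)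
      ((√(n : ℝ))⁻¹ • ξ)) ?_ (by positivity)
    obtain ⟨m, rfl⟩ := Nat.exists_eq_add_of_le' hn2
    exact (hki m).comp_smul hn0
  have hGi' : Integrable fun η : E => cexp ((-a * ‖(2 * Real.pi) • η‖ ^ 2 : ℝ) : ℂ) :=
    hGi.comp_smul (by positivity)
  have hphase : ∀ w η : E, ‖cexp (-⟪w, (2 * Real.pi) • η⟫ * I)‖ = 1 := fun w η => by
    rw [← ofReal_neg, norm_exp_ofReal_mul_I]
  have hphi : ∀ (w : E) {f : E → ℂ}, Integrable f →
      Integrable fun η => cexp (-⟪w, (2 * Real.pi) • η⟫ * I) * f η := fun w f hf =>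
    hf.bdd_mul (c := 1) (Continuous.aestronglyMeasurable (by fun_prop))
      (Eventually.of_forall fun η => (hphase w η).le)
  refine smul_volume_restrict_le_of_inverse_charFun _ ?_ Metric.isOpen_ball (by positivity) ?_
  · simpa only [hchar] using hi
  · intro w hw
    simp only [hchar]
    set A := ∫ η : E, cexp (-⟪w, (2 * Real.pi) • η⟫ * I) *
      charFun (convPowTwo μ₁ μ₂ n) ((√(n : ℝ))⁻¹ • (2 * Real.pi) • η) with hA
    have hG := integral_cexp_inner_mul_gaussian ha w
    set G := ∫ η : E, cexp (-⟪w, (2 * Real.pi) • η⟫ * I) *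
      cexp ((-a * ‖(2 * Real.pi) • η‖ ^ 2 : ℝ) : ℂ) with hGdef
    -- Uniformly in `w`, inverse transforms differ by at most the `L¹` distance of the transforms,
    -- up to the Jacobian of `2π`.
    have hAG : ‖A - G‖ ≤ c / 2 := by
      rw [hA, hGdef, ← integral_sub (hphi w hi) (hphi w hGi')]
      refine le_trans ?_ hn
      refine le_of_le_of_eq ?_ (Measure.integral_comp_smul volume (fun ξ : E =>
        ‖charFun (convPowTwo μ₁ μ₂ n) ((√(n : ℝ))⁻¹ • ξ) - cexp ((-a * ‖ξ‖ ^ 2 : ℝ) : ℂ)‖)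
        (2 * Real.pi))
      refine norm_integral_le_of_norm_le (hi.sub hGi').norm (Eventually.of_forall fun η => ?_)
      rw [← mul_sub, norm_mul, hphase, one_mul]
    have hGc : c ≤ G.re := by
      rw [hG, ofReal_re, hc]
      gcongr
      exact (mem_ball_zero_iff.1 hw).le
    have := (abs_le.1 ((abs_re_le_norm (A - G)).trans hAG)).1
    rw [sub_re] at this
    linarith

end LocalLimitTheorem

/-! ### Second order expansion for the jump kernel. -/

section Kernel

open Filter Topology Complex Asymptotics
open scoped RealInnerProductSpace

namespace NLFP

/-- For `|θ| ≤ 1` use the cubic Taylor remainder and `2 + s ≤ 3`; for `|θ| ≥ 1` bound each term and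
use `2 ≤ 2 + s`. -/
lemma norm_cexp_mul_I_sub_le {s : ℝ} (hs : s ∈ Set.Ioc (0 : ℝ) 1) (θ : ℝ) :
    ‖cexp (θ * I) - (1 + θ * I - (θ ^ 2 / 2 : ℝ))‖ ≤ 4 * |θ| ^ (2 + s) := by
  have hθ : 0 ≤ |θ| := abs_nonneg θ
  rcases le_total |θ| 1 with h | h
  · have h1 : ‖(θ * I : ℂ)‖ = |θ| := by simp
    have h2 := Complex.exp_bound (x := θ * I) (by rwa [h1]) (n := 3) (by norm_num)
    have h3 : ∑ m ∈ Finset.range 3, (θ * I : ℂ) ^ m / (m.factorial : ℂ) =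
        1 + θ * I - (θ ^ 2 / 2 : ℝ) := by
      simp [Finset.sum_range_succ, mul_pow]
      ring
    rw [h3, h1] at h2
    refine h2.trans ?_
    have h4 : |θ| ^ 3 ≤ |θ| ^ (2 + s) := by
      rcases hθ.eq_or_lt with h0 | h0
      · rw [← h0]; norm_num; positivity
      · rw [← Real.rpow_natCast]
        exact Real.rpow_le_rpow_of_exponent_ge h0 h (by push_cast; linarith [hs.2])
    have h5 : 0 ≤ |θ| ^ 3 := by positivity
    have h6 : ((3 : ℕ).succ * ((3 : ℕ).factorial * (3 : ℕ) : ℝ)⁻¹ : ℝ) ≤ 4 := by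
      norm_num [Nat.factorial]
    calc |θ| ^ 3 * ((3 : ℕ).succ * ((3 : ℕ).factorial * (3 : ℕ) : ℝ)⁻¹ : ℝ) ≤ |θ| ^ 3 * 4 := by
          gcongr
      _ ≤ 4 * |θ| ^ (2 + s) := by linarith
  · have h1 : |θ| ^ 2 ≤ |θ| ^ (2 + s) := by
      rw [← Real.rpow_natCast]
      exact Real.rpow_le_rpow_of_exponent_le h (by push_cast; linarith [hs.1])
    calc ‖cexp (θ * I) - (1 + θ * I - (θ ^ 2 / 2 : ℝ))‖
        ≤ 1 + (1 + |θ| + |θ| ^ 2 / 2) := by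
          refine (norm_sub_le _ _).trans (add_le_add (norm_exp_ofReal_mul_I _).le ?_)
          refine (norm_sub_le _ _).trans (add_le_add ((norm_add_le _ _).trans ?_) ?_)
          · simp
          · rw [norm_real, Real.norm_eq_abs, abs_div, abs_pow]; simp
      _ ≤ 4 * |θ| ^ 2 := by nlinarith
      _ ≤ 4 * |θ| ^ (2 + s) := by gcongr

variable {d : ℕ} {J : Space d → ℝ}

/-- The law of a single jump. -/
noncomputable def kernelMeasure (J : Space d → ℝ) : Measure (Space d) :=
  volume.withDensity fun x => ENNReal.ofReal (J x)

lemma integral_kernelMeasure (hJ : IsNormalizedKernel J) (f : Space d → ℂ) :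
    ∫ x, f x ∂kernelMeasure J = ∫ x, J x * f x := by
  rw [kernelMeasure, integral_withDensity_eq_integral_toReal_smul₀
    hJ.integrable.1.aemeasurable.ennreal_ofReal (Eventually.of_forall fun x => ENNReal.ofReal_lt_top)]
  congr with x
  rw [ENNReal.toReal_ofReal (hJ.nonneg x), real_smul]

lemma isProbabilityMeasure_kernelMeasure (hJ : IsNormalizedKernel J) :
    IsProbabilityMeasure (kernelMeasure J) := by
  constructor
  rw [kernelMeasure, withDensity_apply _ MeasurableSet.univ, Measure.restrict_univ,
    ← ofReal_integral_eq_lintegral_ofReal hJ.integrable (Eventually.of_forall hJ.nonneg), hJ.mass,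
    ENNReal.ofReal_one]

lemma kernelMeasure_absolutelyContinuous : kernelMeasure J ≪ volume :=
  withDensity_absolutelyContinuous _ _

lemma IsNormalizedKernel.integrable_mul_sq (hJ : IsNormalizedKernel J) {s : ℝ} (hs : 0 < s)
    (hJs : Integrable fun x => J x * ‖x‖ ^ (2 + s)) : Integrable fun x => J x * ‖x‖ ^ 2 := by
  refine (hJ.integrable.add hJs).mono' ?_ (Eventually.of_forall fun x => ?_)
  · exact hJ.integrable.1.mul (by fun_prop)
  · have h0 := hJ.nonneg x
    rw [Real.norm_of_nonneg (by positivity)]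
    have : ‖x‖ ^ 2 ≤ 1 + ‖x‖ ^ (2 + s) := by
      rcases le_total ‖x‖ 1 with h | h
      · have h1 : ‖x‖ ^ 2 ≤ 1 := pow_le_one₀ (norm_nonneg _) h
        have h2 : 0 ≤ ‖x‖ ^ (2 + s) := by positivity
        linarith
      · have h1 : ‖x‖ ^ 2 ≤ ‖x‖ ^ (2 + s) := by
          rw [← Real.rpow_natCast]
          exact Real.rpow_le_rpow_of_exponent_le h (by push_cast; linarith)
        linarith
    calc J x * ‖x‖ ^ 2 ≤ J x * (1 + ‖x‖ ^ (2 + s)) := by gcongr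
      _ = _ := by simp only [Pi.add_apply]; ring

lemma IsNormalizedKernel.integrable_mul_norm (hJ : IsNormalizedKernel J)
    (hJ2 : Integrable fun x => J x * ‖x‖ ^ 2) : Integrable fun x => J x * ‖x‖ := by
  refine (hJ.integrable.add hJ2).mono' ?_ (Eventually.of_forall fun x => ?_)
  · exact hJ.integrable.1.mul (by fun_prop)
  · have h0 := hJ.nonneg x
    rw [Real.norm_of_nonneg (by positivity)]
    calc J x * ‖x‖ ≤ J x * (1 + ‖x‖ ^ 2) := by gcongr; nlinarith [sq_nonneg (‖x‖ - 1)]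
      _ = _ := by simp only [Pi.add_apply]; ring

lemma IsNormalizedKernel.integral_mul_inner (hJ : IsNormalizedKernel J)
    (hJ2 : Integrable fun x => J x * ‖x‖ ^ 2) (η : Space d) : ∫ x, J x * ⟪x, η⟫ = 0 := by
  have hi : Integrable fun x => J x • x := by
    refine (hJ.integrable_mul_norm hJ2).mono' (hJ.integrable.1.smul (by fun_prop))
      (Eventually.of_forall fun x => ?_)
    rw [norm_smul, Real.norm_of_nonneg (hJ.nonneg x)]
  have := integral_inner (𝕜 := ℝ) hi η
  rw [hJ.mean, inner_zero_right] at this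
  rw [← this]
  congr with x
  rw [inner_smul_right, real_inner_comm]

lemma IsNormalizedKernel.integrable_mul_coord (hJ : IsNormalizedKernel J)
    (hJ2 : Integrable fun x => J x * ‖x‖ ^ 2) (i j : Fin d) :
    Integrable fun x => J x * (x i * x j) := by
  refine hJ2.mono' (hJ.integrable.1.mul (Continuous.aestronglyMeasurable (by fun_prop)))
    (Eventually.of_forall fun x => ?_)
  rw [norm_mul, norm_mul, Real.norm_of_nonneg (hJ.nonneg x), pow_two]
  have := hJ.nonneg x
  gcongr <;> exact PiLp.norm_apply_le x _

lemma IsNormalizedKernel.integral_mul_inner_sq (hJ : IsNormalizedKernel J)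
    (hJ2 : Integrable fun x => J x * ‖x‖ ^ 2) (η : Space d) :
    ∫ x, J x * ⟪x, η⟫ ^ 2 = 2 * ‖η‖ ^ 2 := by
  have h1 : ∀ x : Space d, J x * ⟪x, η⟫ ^ 2 =
      ∑ i, ∑ j, (η i * η j) * (J x * (x i * x j)) := by
    intro x
    have : ⟪x, η⟫ = ∑ i, x i * η i := by
      simp [PiLp.inner_apply, mul_comm]
    rw [this, pow_two, Finset.sum_mul_sum, Finset.mul_sum]
    refine Finset.sum_congr rfl fun i _ => ?_
    rw [Finset.mul_sum]
    refine Finset.sum_congr rfl fun j _ => ?_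
    ring
  simp_rw [h1]
  rw [integral_finsetSum _ fun i _ => integrable_finsetSum _ fun j _ =>
    (hJ.integrable_mul_coord hJ2 i j).const_mul _]
  have h2 : ∀ i, ∫ x : Space d, ∑ j, (η i * η j) * (J x * (x i * x j)) = 2 * η i ^ 2 := by
    intro i
    rw [integral_finsetSum _ fun j _ => (hJ.integrable_mul_coord hJ2 i j).const_mul _]
    simp_rw [integral_const_mul, hJ.second]
    simp
    ring
  simp_rw [h2]
  rw [← Finset.mul_sum, EuclideanSpace.norm_sq_eq]
  simp

/-- Second order expansion of the characteristic function of the jump law. -/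
lemma IsNormalizedKernel.norm_charFun_sub_le (hJ : IsNormalizedKernel J) {s : ℝ}
    (hs : s ∈ Set.Ioc (0 : ℝ) 1) (hJs : Integrable fun x => J x * ‖x‖ ^ (2 + s)) (η : Space d) :
    ‖charFun (kernelMeasure J) η - (1 - ‖η‖ ^ 2 : ℝ)‖ ≤
      4 * (∫ x, J x * ‖x‖ ^ (2 + s)) * ‖η‖ ^ (2 + s) := by
  have hJ2 := hJ.integrable_mul_sq hs.1 hJs
  have hm : ∀ {f : Space d → ℝ}, Continuous f → AEStronglyMeasurable (fun x => J x * f x) :=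
    fun hf => hJ.integrable.1.mul hf.aestronglyMeasurable
  have hi1 : Integrable fun x => J x * ⟪x, η⟫ := by
    refine ((hJ.integrable_mul_norm hJ2).mul_const ‖η‖).mono' (hm (by fun_prop))
      (Eventually.of_forall fun x => ?_)
    rw [norm_mul, Real.norm_of_nonneg (hJ.nonneg x), mul_assoc]
    exact mul_le_mul_of_nonneg_left (norm_inner_le_norm _ _) (hJ.nonneg x)
  have hi2 : Integrable fun x => J x * ⟪x, η⟫ ^ 2 := by
    refine (hJ2.mul_const (‖η‖ ^ 2)).mono' (hm (by fun_prop)) (Eventually.of_forall fun x => ?_)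
    rw [norm_mul, Real.norm_of_nonneg (hJ.nonneg x), mul_assoc, norm_pow, ← mul_pow]
    exact mul_le_mul_of_nonneg_left (pow_le_pow_left₀ (norm_nonneg _) (norm_inner_le_norm _ _) _)
      (hJ.nonneg x)
  have hi0 : Integrable fun x => (J x : ℂ) * cexp (⟪x, η⟫ * I) := by
    refine (hJ.integrable.ofReal (𝕜 := ℂ)).mul_bdd (c := 1)
      (Continuous.aestronglyMeasurable (by fun_prop)) (Eventually.of_forall fun x => ?_)
    rw [norm_exp_ofReal_mul_I]
  have h1 : ∀ x : Space d, (J x : ℂ) * (1 + ⟪x, η⟫ * I - (⟪x, η⟫ ^ 2 / 2 : ℝ)) =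
      ((J x : ℝ) : ℂ) + ((J x * ⟪x, η⟫ : ℝ) : ℂ) * I - ((J x * ⟪x, η⟫ ^ 2 / 2 : ℝ) : ℂ) := by
    intro x; push_cast; ring
  have j0 : Integrable fun x => ((J x : ℝ) : ℂ) := hJ.integrable.ofReal
  have j1 : Integrable fun x => ((J x * ⟪x, η⟫ : ℝ) : ℂ) * I := hi1.ofReal.mul_const I
  have j01 : Integrable fun x => ((J x : ℝ) : ℂ) + ((J x * ⟪x, η⟫ : ℝ) : ℂ) * I := j0.add j1
  have j2 : Integrable fun x => ((J x * ⟪x, η⟫ ^ 2 / 2 : ℝ) : ℂ) := (hi2.div_const 2).ofReal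
  have hi3 : Integrable fun x => (J x : ℂ) * (1 + ⟪x, η⟫ * I - (⟪x, η⟫ ^ 2 / 2 : ℝ)) := by
    simp_rw [h1]
    exact j01.sub j2
  have e3 : ∫ x, (J x : ℂ) * (1 + ⟪x, η⟫ * I - (⟪x, η⟫ ^ 2 / 2 : ℝ)) = (1 - ‖η‖ ^ 2 : ℝ) := by
    simp_rw [h1]
    rw [integral_sub j01 j2, integral_add j0 j1, integral_mul_const,
      integral_complex_ofReal, integral_complex_ofReal, integral_complex_ofReal,
      integral_div, hJ.mass, hJ.integral_mul_inner hJ2, hJ.integral_mul_inner_sq hJ2]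
    push_cast
    ring
  rw [charFun_apply, integral_kernelMeasure hJ, ← e3, ← integral_sub hi0 hi3]
  have hb : Integrable fun x => 4 * (J x * ‖x‖ ^ (2 + s)) * ‖η‖ ^ (2 + s) :=
    (hJs.const_mul 4).mul_const _
  calc _ ≤ ∫ x, 4 * (J x * ‖x‖ ^ (2 + s)) * ‖η‖ ^ (2 + s) := by
        refine norm_integral_le_of_norm_le hb (Eventually.of_forall fun x => ?_)
        have h0 := hJ.nonneg x
        rw [← mul_sub, norm_mul, norm_real, Real.norm_of_nonneg h0]
        calc _ ≤ J x * (4 * |⟪x, η⟫| ^ (2 + s)) := by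
              gcongr
              exact norm_cexp_mul_I_sub_le hs _
          _ ≤ J x * (4 * (‖x‖ * ‖η‖) ^ (2 + s)) := by
              have := hs.1
              gcongr
              exact abs_real_inner_le_norm _ _
          _ = _ := by
              rw [Real.mul_rpow (norm_nonneg _) (norm_nonneg _)]; ring
    _ = _ := by rw [integral_mul_const, integral_const_mul]

end NLFP

end Kernel

/-! ### The law of a jump at a uniform time, contracted by the drift. -/

section RelaxedJump

open Filter Topology Complex Asymptotics
open scoped RealInnerProductSpace

namespace NLFP

variable {d : ℕ} {J : Space d → ℝ}

/-- The uniform distribution on `(0, t]`. -/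
noncomputable def uniformTime (t : ℝ) : Measure ℝ :=
  (ENNReal.ofReal t)⁻¹ • volume.restrict (Set.Ioc 0 t)

lemma isProbabilityMeasure_uniformTime {t : ℝ} (ht : 0 < t) :
    IsProbabilityMeasure (uniformTime t) := by
  constructor
  rw [uniformTime, Measure.smul_apply, Measure.restrict_apply_univ, Real.volume_Ioc, sub_zero,
    smul_eq_mul, ENNReal.inv_mul_cancel (by simpa using ht) ENNReal.ofReal_ne_top]

lemma integral_uniformTime {F : Type*} [NormedAddCommGroup F] [NormedSpace ℝ F] {t : ℝ}
    (ht : 0 < t) (f : ℝ → F) : ∫ σ, f σ ∂uniformTime t = t⁻¹ • ∫ σ in (0 : ℝ)..t, f σ := by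
  rw [uniformTime, integral_smul_measure, intervalIntegral.integral_of_le ht.le,
    ENNReal.toReal_inv, ENNReal.toReal_ofReal ht.le]

/-- The law at time `t` of a jump with distribution `J` made at a uniformly distributed time
`σ ∈ (0, t]` and contracted by the drift since. -/
noncomputable def relaxedJumpMeasure (J : Space d → ℝ) (t : ℝ) : Measure (Space d) :=
  ((uniformTime t).prod (kernelMeasure J)).map fun p => Real.exp (p.1 - t) • p.2

lemma isProbabilityMeasure_relaxedJumpMeasure (hJ : IsNormalizedKernel J) {t : ℝ} (ht : 0 < t) :
    IsProbabilityMeasure (relaxedJumpMeasure J t) := by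
  have := isProbabilityMeasure_kernelMeasure hJ
  have := isProbabilityMeasure_uniformTime ht
  exact Measure.isProbabilityMeasure_map (Measurable.aemeasurable (by fun_prop))

/-- This time average is the one produced by integrating the Fourier equation along characteristics,
which is why this law represents the solution. -/
lemma charFun_relaxedJumpMeasure (hJ : IsNormalizedKernel J) {t : ℝ} (ht : 0 < t) (ξ : Space d) :
    charFun (relaxedJumpMeasure J t) ξ =
      t⁻¹ * ∫ σ in (0 : ℝ)..t, charFun (kernelMeasure J) (Real.exp (σ - t) • ξ) := by
  have := isProbabilityMeasure_kernelMeasure hJ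
  have := isProbabilityMeasure_uniformTime ht
  have hint : Integrable (fun p : ℝ × Space d => cexp (⟪Real.exp (p.1 - t) • p.2, ξ⟫ * I))
      ((uniformTime t).prod (kernelMeasure J)) := by
    refine (integrable_const (1 : ℝ)).mono' (Continuous.aestronglyMeasurable (by fun_prop))
      (Eventually.of_forall fun p => (norm_exp_ofReal_mul_I _).le)
  rw [charFun_apply, relaxedJumpMeasure, integral_map (Measurable.aemeasurable (by fun_prop))
    (Continuous.aestronglyMeasurable (by fun_prop)), integral_prod _ hint, integral_uniformTime ht,
    real_smul]
  congr 1
  refine intervalIntegral.integral_congr fun σ _ => ?_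
  simp only [charFun_apply]
  congr with y
  rw [inner_smul_left, inner_smul_right]
  simp

/-- At each fixed time the contraction is an invertible dilation, so null sets have null preimages
slice by slice. -/
lemma relaxedJumpMeasure_absolutelyContinuous (hJ : IsNormalizedKernel J) {t : ℝ} :
    relaxedJumpMeasure J t ≪ volume := by
  have := isProbabilityMeasure_kernelMeasure hJ
  refine Measure.AbsolutelyContinuous.mk fun N hN hN0 => ?_
  have hm : Measurable fun p : ℝ × Space d => Real.exp (p.1 - t) • p.2 := by fun_prop
  rw [relaxedJumpMeasure, Measure.map_apply hm hN, Measure.measure_prod_null (hm hN)]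
  refine Eventually.of_forall fun σ => kernelMeasure_absolutelyContinuous ?_
  have : Prod.mk σ ⁻¹' ((fun p : ℝ × Space d => Real.exp (p.1 - t) • p.2) ⁻¹' N) =
      (fun y : Space d => Real.exp (σ - t) • y) ⁻¹' N := rfl
  rw [this, Measure.addHaar_preimage_smul _ (Real.exp_pos _).ne', hN0, mul_zero]

/-- The variance parameter of `relaxedJumpMeasure`. -/
lemma integral_exp_two_mul_sub_pos {t : ℝ} (ht : 0 < t) :
    0 < t⁻¹ * ∫ σ in (0 : ℝ)..t, Real.exp (σ - t) ^ 2 := by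
  refine mul_pos (inv_pos.2 ht) ?_
  exact intervalIntegral.intervalIntegral_pos_of_pos
    (Continuous.intervalIntegrable (by fun_prop) _ _) (fun σ => by positivity) ht

/-- The expansion for `J` is averaged over the jump time; the contraction factor is at most `1`, so
it does not enlarge the remainder. -/
lemma isLittleO_charFun_relaxedJumpMeasure (hJ : IsNormalizedKernel J) {s : ℝ}
    (hs : s ∈ Set.Ioc (0 : ℝ) 1) (hJs : Integrable fun x => J x * ‖x‖ ^ (2 + s)) {t : ℝ}
    (ht : 0 < t) :
    (fun ξ : Space d => charFun (relaxedJumpMeasure J t) ξ -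
      (1 - (t⁻¹ * ∫ σ in (0 : ℝ)..t, Real.exp (σ - t) ^ 2) * ‖ξ‖ ^ 2 : ℝ))
      =o[𝓝 0] fun ξ => ‖ξ‖ ^ 2 := by
  have := isProbabilityMeasure_kernelMeasure hJ
  set C := 4 * ∫ x, J x * ‖x‖ ^ (2 + s) with hC
  have hC0 : 0 ≤ C := by
    have : 0 ≤ ∫ x, J x * ‖x‖ ^ (2 + s) :=
      integral_nonneg fun x => mul_nonneg (hJ.nonneg x) (by positivity)
    positivity
  have hbound : ∀ ξ : Space d, ‖charFun (relaxedJumpMeasure J t) ξ -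
      (1 - (t⁻¹ * ∫ σ in (0 : ℝ)..t, Real.exp (σ - t) ^ 2) * ‖ξ‖ ^ 2 : ℝ)‖ ≤
      C * ‖ξ‖ ^ (2 + s) := by
    intro ξ
    have e1 : ((1 - (t⁻¹ * ∫ σ in (0 : ℝ)..t, Real.exp (σ - t) ^ 2) * ‖ξ‖ ^ 2 : ℝ) : ℂ) =
        t⁻¹ * ∫ σ in (0 : ℝ)..t, ((1 - ‖Real.exp (σ - t) • ξ‖ ^ 2 : ℝ) : ℂ) := by
      rw [intervalIntegral.integral_ofReal, ← ofReal_mul]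
      congr 1
      have : ∀ σ : ℝ, 1 - ‖Real.exp (σ - t) • ξ‖ ^ 2 = 1 - Real.exp (σ - t) ^ 2 * ‖ξ‖ ^ 2 := by
        intro σ
        rw [norm_smul, mul_pow, Real.norm_of_nonneg (Real.exp_pos _).le]
      simp_rw [this]
      rw [intervalIntegral.integral_sub (by simp)
        (Continuous.intervalIntegrable (by fun_prop) _ _), intervalIntegral.integral_mul_const]
      simp only [intervalIntegral.integral_const, sub_zero, smul_eq_mul, mul_one]
      field_simp
    have hc : Continuous fun σ : ℝ => charFun (kernelMeasure J) (Real.exp (σ - t) • ξ) :=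
      continuous_charFun.comp (by fun_prop)
    rw [charFun_relaxedJumpMeasure hJ ht, e1, ← mul_sub, ← intervalIntegral.integral_sub
      (hc.intervalIntegrable _ _) (Continuous.intervalIntegrable (by fun_prop) _ _), norm_mul]
    have h1 : ‖∫ σ in (0 : ℝ)..t, (charFun (kernelMeasure J) (Real.exp (σ - t) • ξ) -
        ((1 - ‖Real.exp (σ - t) • ξ‖ ^ 2 : ℝ) : ℂ))‖ ≤ (C * ‖ξ‖ ^ (2 + s)) * |t - 0| := by
      refine intervalIntegral.norm_integral_le_of_norm_le_const fun σ hσ => ?_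
      rw [Set.uIoc_of_le ht.le] at hσ
      refine (hJ.norm_charFun_sub_le hs hJs _).trans ?_
      have h2 : ‖Real.exp (σ - t) • ξ‖ ≤ ‖ξ‖ := by
        rw [norm_smul, Real.norm_of_nonneg (Real.exp_pos _).le]
        exact mul_le_of_le_one_left (norm_nonneg _) (Real.exp_le_one_iff.2 (by linarith [hσ.2]))
      have := hs.1
      gcongr
    rw [sub_zero, abs_of_pos ht] at h1
    calc _ ≤ t⁻¹ * ((C * ‖ξ‖ ^ (2 + s)) * t) := by
          rw [norm_real, Real.norm_of_nonneg (inv_pos.2 ht).le]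
          gcongr
      _ = _ := by field_simp
  refine IsBigO.trans_isLittleO (g := fun ξ : Space d => ‖ξ‖ ^ 2 * ‖ξ‖ ^ s) ?_ ?_
  · refine IsBigO.of_bound C (Eventually.of_forall fun ξ => (hbound ξ).trans_eq ?_)
    rw [Real.norm_of_nonneg (by positivity), ← Real.rpow_natCast,
      ← Real.rpow_add_of_nonneg (norm_nonneg _) (by norm_num) hs.1.le]
    norm_num
  · have h0 : Tendsto (fun ξ : Space d => ‖ξ‖ ^ s) (𝓝 0) (𝓝 0) := by
      have : ContinuousAt (fun ξ : Space d => ‖ξ‖ ^ s) 0 :=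
        (continuous_norm.rpow_const fun _ => Or.inr hs.1.le).continuousAt
      simpa [ContinuousAt, Real.zero_rpow hs.1.ne'] using this
    simpa using (isBigO_refl (fun ξ : Space d => ‖ξ‖ ^ 2) (𝓝 0)).mul_isLittleO
      ((isLittleO_one_iff ℝ).2 h0)

end NLFP

end RelaxedJump

/-! ### Fourier transform of mild solutions. -/

section MildSolution

open Filter Topology Complex
open scoped RealInnerProductSpace

namespace NLFP

variable {d : ℕ} {J : Space d → ℝ}

/-- The Fourier transform of `f`, normalized as for characteristic functions. -/
noncomputable def fourierMode (f : Space d → ℝ) (ξ : Space d) : ℂ :=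
  ∫ x, cexp (⟪x, ξ⟫ * I) * f x

lemma fourierMode_congr_ae {f g : Space d → ℝ} (h : f =ᵐ[volume] g) (ξ : Space d) :
    fourierMode f ξ = fourierMode g ξ := by
  refine integral_congr_ae ?_
  filter_upwards [h] with x hx
  rw [hx]

lemma integrable_cexp_mul {f : Space d → ℝ} (hf : Integrable f) (ξ : Space d) :
    Integrable fun x => cexp (⟪x, ξ⟫ * I) * f x :=
  (hf.ofReal (𝕜 := ℂ)).bdd_mul (c := 1) (Continuous.aestronglyMeasurable (by fun_prop))
    (Eventually.of_forall fun x => (norm_exp_ofReal_mul_I _).le)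

lemma norm_fourierMode_le (f : Space d → ℝ) (ξ : Space d) :
    ‖fourierMode f ξ‖ ≤ ∫ x, ‖f x‖ := by
  refine (norm_integral_le_integral_norm _).trans_eq ?_
  congr with x
  rw [norm_mul, norm_exp_ofReal_mul_I, one_mul, norm_real]

lemma continuous_fourierMode {f : Space d → ℝ} (hf : Integrable f) :
    Continuous (fourierMode f) := by
  refine continuous_of_dominated (bound := fun x => ‖f x‖) (fun ξ => (integrable_cexp_mul hf ξ).1)
    (fun ξ => Eventually.of_forall fun x => ?_) hf.norm (Eventually.of_forall fun x => by fun_prop)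
  rw [norm_mul, norm_exp_ofReal_mul_I, one_mul, norm_real]

/-- The Jacobian of the dilation cancels `exp (d τ)`, leaving the killing rate `1 / ε²` and a
contracted frequency. -/
lemma fourierMode_transport (ε τ : ℝ) (f : Space d → ℝ) (ξ : Space d) :
    fourierMode (transport ε τ f) ξ =
      (Real.exp (-(1 / ε ^ 2) * τ) : ℝ) * fourierMode f (Real.exp (-τ) • ξ) := by
  have h := Measure.integral_comp_smul (volume : Measure (Space d))
    (fun x => cexp (⟪x, Real.exp (-τ) • ξ⟫ * I) * f x) (Real.exp τ)
  have h1 : ∀ x : Space d, ⟪Real.exp τ • x, Real.exp (-τ) • ξ⟫ = ⟪x, ξ⟫ := by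
    intro x
    rw [inner_smul_left, inner_smul_right, ← mul_assoc]
    simp [← Real.exp_add]
  simp only [h1, finrank_euclideanSpace_fin] at h
  have h2 : fourierMode (transport ε τ f) ξ = (Real.exp (((d : ℝ) - 1 / ε ^ 2) * τ) : ℝ) *
      ∫ x, cexp (⟪x, ξ⟫ * I) * f (Real.exp τ • x) := by
    rw [← integral_const_mul, fourierMode]
    congr with x
    rw [transport]
    push_cast
    ring
  rw [h2, h, abs_of_pos (by positivity), real_smul, ← mul_assoc, ← ofReal_mul, fourierMode,
    ← Real.exp_nat_mul, ← Real.exp_neg, ← Real.exp_add]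
  congr 4
  ring

lemma integrable_scaledKernel (hJ : IsNormalizedKernel J) {ε : ℝ} (hε : 0 < ε) :
    Integrable (scaledKernel J ε) :=
  (hJ.integrable.comp_smul (inv_pos.2 hε).ne').const_mul _

lemma fourierMode_scaledKernel (hJ : IsNormalizedKernel J) {ε : ℝ} (hε : 0 < ε) (ξ : Space d) :
    fourierMode (scaledKernel J ε) ξ = charFun (kernelMeasure J) (ε • ξ) := by
  have h := Measure.integral_comp_smul (volume : Measure (Space d))
    (fun x => cexp (⟪x, ε • ξ⟫ * I) * J x) ε⁻¹
  have h1 : ∀ x : Space d, ⟪ε⁻¹ • x, ε • ξ⟫ = ⟪x, ξ⟫ := by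
    intro x
    rw [inner_smul_left, inner_smul_right, ← mul_assoc]
    simp [hε.ne']
  simp only [h1, finrank_euclideanSpace_fin] at h
  have h2 : fourierMode (scaledKernel J ε) ξ = ((ε ^ d)⁻¹ : ℝ) *
      ∫ x, cexp (⟪x, ξ⟫ * I) * J (ε⁻¹ • x) := by
    rw [← integral_const_mul, fourierMode]
    congr with x
    rw [scaledKernel]
    push_cast
    ring
  rw [h2, h, abs_of_pos (by positivity), real_smul, ← mul_assoc, ← ofReal_mul, inv_pow, inv_inv,
    inv_mul_cancel₀ (by positivity), ofReal_one, one_mul, charFun_apply, integral_kernelMeasure hJ]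
  congr with x
  ring

lemma fourierMode_jump (hJ : IsNormalizedKernel J) {ε : ℝ} (hε : 0 < ε) {f : Space d → ℝ}
    (hf : Integrable f) (ξ : Space d) :
    fourierMode (jump J ε f) ξ = charFun (kernelMeasure J) (ε • ξ) * fourierMode f ξ := by
  have h : ∀ x, cexp (⟪x, ξ⟫ * I) * jump J ε f x =
      convolution (fun y => cexp (⟪y, ξ⟫ * I) * scaledKernel J ε y)
        (fun y => cexp (⟪y, ξ⟫ * I) * f y) (ContinuousLinearMap.mul ℂ ℂ) volume x := by
    intro x
    rw [jump, convolution_def, convolution_def, ← integral_complex_ofReal, ← integral_const_mul]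
    congr with y
    simp only [ContinuousLinearMap.mul_apply']
    rw [inner_sub_left, ofReal_sub, sub_mul, Complex.exp_sub]
    have := Complex.exp_ne_zero (⟪y, ξ⟫ * I)
    push_cast
    field_simp
  rw [fourierMode]
  simp_rw [h]
  rw [integral_convolution (ContinuousLinearMap.mul ℂ ℂ)
    (integrable_cexp_mul (integrable_scaledKernel hJ hε) ξ) (integrable_cexp_mul hf ξ),
    ← fourierMode_scaledKernel hJ hε]
  rfl

lemma volume_le_weightedMeasure (k : ℝ) : (volume : Measure (Space d)) ≤ weightedMeasure d k := by
  calc (volume : Measure (Space d)) = volume.withDensity 1 := withDensity_one.symm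
    _ ≤ _ := withDensity_mono (Eventually.of_forall fun x => by
        have : 0 ≤ ‖x‖ ^ k := by positivity
        simpa using this)

lemma volume_absolutelyContinuous_weightedMeasure (k : ℝ) :
    (volume : Measure (Space d)) ≪ weightedMeasure d k :=
  (volume_le_weightedMeasure k).absolutelyContinuous

lemma WeightedL1.integrable {k : ℝ} (f : WeightedL1 d k) : Integrable f :=
  (L1.integrable_coeFn f).mono_measure (volume_le_weightedMeasure k)

/-- The Fourier transform at a fixed frequency as a continuous functional on `L¹_k`. -/
noncomputable def fourierModeCLM (k : ℝ) (ξ : Space d) : WeightedL1 d k →L[ℝ] ℂ :=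
  LinearMap.mkContinuous
    { toFun := fun f => fourierMode f ξ
      map_add' := fun f g => by
        have h := (volume_absolutelyContinuous_weightedMeasure k).ae_le (Lp.coeFn_add f g)
        rw [fourierMode_congr_ae h, fourierMode, fourierMode, fourierMode,
          ← integral_add (integrable_cexp_mul f.integrable ξ) (integrable_cexp_mul g.integrable ξ)]
        congr with x
        simp [mul_add]
      map_smul' := fun c f => by
        have h := (volume_absolutelyContinuous_weightedMeasure k).ae_le (Lp.coeFn_smul c f)
        rw [fourierMode_congr_ae h, fourierMode, fourierMode, RingHom.id_apply, ← integral_smul]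
        congr with x
        simp
        ring } 1 fun f => by
      simp only [LinearMap.coe_mk, AddHom.coe_mk]
      rw [one_mul, L1.norm_eq_integral_norm]
      exact (norm_fourierMode_le f ξ).trans (integral_mono_measure (volume_le_weightedMeasure k)
        (Eventually.of_forall fun x => norm_nonneg _) (L1.integrable_coeFn f).norm)

lemma fourierModeCLM_apply {k : ℝ} (ξ : Space d) (f : WeightedL1 d k) :
    fourierModeCLM k ξ f = fourierMode f ξ := rfl

lemma norm_fourierModeCLM_le (k : ℝ) (ξ : Space d) : ‖fourierModeCLM k ξ‖ ≤ 1 :=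
  LinearMap.mkContinuous_norm_le _ zero_le_one _

/-- Joint continuity is needed because the frequency moves with time. It follows from a Lipschitz
bound in `f` that is uniform in the frequency. -/
lemma continuous_fourierMode_prod (k : ℝ) :
    Continuous fun p : WeightedL1 d k × Space d => fourierMode p.1 p.2 := by
  refine continuous_prod_of_continuous_lipschitzWith _ 1
    (fun f => continuous_fourierMode f.integrable) fun ξ => ?_
  have h := (fourierModeCLM k ξ).lipschitz
  exact h.weaken (by simpa using! norm_fourierModeCLM_le k ξ)

/-- A continuous solution of a scalar linear Volterra equation is an exponential. -/
lemma eq_mul_exp_of_eq_add_integral {w m : ℝ → ℂ} {w₀ : ℂ} {l t : ℝ} (ht : 0 ≤ t)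
    (hm : Continuous m) (hw : ContinuousOn w (Set.Icc 0 t))
    (h : ∀ τ ∈ Set.Icc 0 t, w τ = w₀ + l * ∫ σ in (0 : ℝ)..τ, m σ * w σ) :
    w t = w₀ * cexp (l * ∫ σ in (0 : ℝ)..t, m σ) := by
  -- Extending `w` by its endpoint values makes the integrand continuous on all of `ℝ`, so the
  -- primitive is differentiable everywhere.
  set v : ℝ → ℂ := fun τ => Set.IccExtend ht (Set.domRestrict (Set.Icc 0 t) w) τ with hv
  have hvc : Continuous v := (continuousOn_iff_continuous_domRestrict.1 hw).Icc_extend'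
  have hvw : ∀ τ ∈ Set.Icc 0 t, v τ = w τ := fun τ hτ => by
    rw [hv]
    exact Set.IccExtend_of_mem ht _ hτ
  have hV : ∀ τ : ℝ, HasDerivAt (fun τ => w₀ + l * ∫ σ in (0 : ℝ)..τ, m σ * v σ)
      (l * (m τ * v τ)) τ := fun τ =>
    (((hm.mul hvc).integral_hasStrictDerivAt 0 τ).hasDerivAt.const_mul (l : ℂ)).const_add w₀
  have hM : ∀ τ : ℝ, HasDerivAt (fun τ => cexp (-(l * ∫ σ in (0 : ℝ)..τ, m σ)))
      (cexp (-(l * ∫ σ in (0 : ℝ)..τ, m σ)) * -(l * m τ)) τ := fun τ =>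
    ((hm.integral_hasStrictDerivAt 0 τ).hasDerivAt.const_mul (l : ℂ)).neg.cexp
  have hVv : ∀ τ ∈ Set.Icc 0 t, w₀ + l * (∫ σ in (0 : ℝ)..τ, m σ * v σ) = v τ := by
    intro τ hτ
    rw [hvw τ hτ, h τ hτ]
    congr 2
    refine intervalIntegral.integral_congr fun σ hσ => ?_
    rw [Set.uIcc_of_le hτ.1] at hσ
    simp only [hvw σ ⟨hσ.1, hσ.2.trans hτ.2⟩]
  have hz := fun τ => (hV τ).mul (hM τ)
  -- The right-hand side of the equation times the integrating factor has zero derivative on `[0,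
  -- t)`.
  have key := constant_of_has_deriv_right_zero (a := 0) (b := t)
    (fun τ _ => (hz τ).continuousAt.continuousWithinAt) (fun τ hτ => by
      refine (hz τ).hasDerivWithinAt.congr_deriv ?_
      rw [hVv τ ⟨hτ.1, hτ.2.le⟩]
      ring) t ⟨ht, le_rfl⟩
  simp only [Pi.mul_apply] at key
  rw [hVv t ⟨ht, le_rfl⟩, hvw t ⟨ht, le_rfl⟩] at key
  simp only [intervalIntegral.integral_same, mul_zero, add_zero, neg_zero, Complex.exp_zero,
    mul_one] at key
  rw [← key, mul_assoc, ← Complex.exp_add]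
  simp

/-- The Fourier transform of a mild solution. -/
theorem IsMildSolution.fourierMode_eq (hJ : IsNormalizedKernel J) {ε k : ℝ} (hε : 0 < ε)
    {T : EReal} {u₀ : Space d → ℝ} {u : ℝ → WeightedL1 d k} (hu : IsMildSolution J ε k T u₀ u)
    {t : ℝ} (ht : 0 < t) (htT : (t : EReal) < T) (ξ : Space d) :
    fourierMode (u t) ξ = fourierMode u₀ (Real.exp (-t) • ξ) *
      cexp ((t / ε ^ 2 : ℝ) * (charFun (relaxedJumpMeasure J t) (ε • ξ) - 1)) := by
  have hprob := isProbabilityMeasure_kernelMeasure hJ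
  have hsub : ∀ τ ∈ Set.Icc 0 t, 0 ≤ τ ∧ (τ : EReal) < T := fun τ hτ =>
    ⟨hτ.1, lt_of_le_of_lt (EReal.coe_le_coe_iff.2 hτ.2) htT⟩
  set m : ℝ → ℂ := fun σ => charFun (kernelMeasure J) (Real.exp (σ - t) • ε • ξ) with hm
  have hmc : Continuous m := continuous_charFun.comp (by fun_prop)
  -- The frequency `exp (τ - t) • ξ` follows the characteristic ending at `ξ`, and `exp (τ / ε²)`
  -- removes the killing. The initial datum is then always read at `exp (-t) • ξ`, so the
  -- inhomogeneous term is constant in `τ`.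
  set w : ℝ → ℂ := fun τ => (Real.exp (τ / ε ^ 2) : ℝ) * fourierMode (u τ) (Real.exp (τ - t) • ξ)
    with hw
  have hwc : ContinuousOn w (Set.Icc 0 t) := by
    have h1 : ContinuousOn (fun τ => (u τ, Real.exp (τ - t) • ξ)) (Set.Icc 0 t) :=
      (hu.continuousOn.mono hsub).prodMk (Continuous.continuousOn (by fun_prop))
    have h2 : ContinuousOn (fun τ => fourierMode (u τ) (Real.exp (τ - t) • ξ)) (Set.Icc 0 t) :=
      Continuous.comp_continuousOn (f := fun τ => (u τ, Real.exp (τ - t) • ξ))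
        (continuous_fourierMode_prod k) h1
    have h3 : Continuous fun τ : ℝ => ((Real.exp (τ / ε ^ 2) : ℝ) : ℂ) := by fun_prop
    exact h3.continuousOn.mul h2
  have heq : ∀ τ ∈ Set.Icc 0 t, w τ = fourierMode u₀ (Real.exp (-t) • ξ) +
      ((1 / ε ^ 2 : ℝ) : ℂ) * ∫ σ in (0 : ℝ)..τ, m σ * w σ := by
    intro τ hτ
    obtain ⟨v, g, hv, hg, hgi, hut⟩ := hu.duhamel τ hτ.1 (hsub τ hτ).2
    have h1 := congrArg (fourierModeCLM k (Real.exp (τ - t) • ξ)) hut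
    rw [map_add, map_smul, ← ContinuousLinearMap.intervalIntegral_comp_comm _ hgi] at h1
    simp only [fourierModeCLM_apply] at h1
    have h2 : ∫ σ in (0 : ℝ)..τ, fourierMode (g σ) (Real.exp (τ - t) • ξ) =
        ∫ σ in (0 : ℝ)..τ, (Real.exp (-(τ / ε ^ 2)) : ℝ) * (m σ * w σ) := by
      refine intervalIntegral.integral_congr fun σ hσ => ?_
      rw [Set.uIcc_of_le hτ.1] at hσ
      rw [fourierMode_congr_ae (hg σ hσ), fourierMode_transport,
        fourierMode_jump hJ hε (u σ).integrable, smul_smul (Real.exp (-(τ - σ))),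
        ← Real.exp_add, hm, hw]
      simp only
      rw [show -(τ - σ) + (τ - t) = σ - t by ring, smul_comm ε,
        show -(1 / ε ^ 2) * (τ - σ) = -(τ / ε ^ 2) + σ / ε ^ 2 by ring, Real.exp_add]
      push_cast
      ring
    rw [h2, fourierMode_congr_ae hv, fourierMode_transport, smul_smul, ← Real.exp_add,
      intervalIntegral.integral_const_mul, show -τ + (τ - t) = -t by ring,
      show -(1 / ε ^ 2) * τ = -(τ / ε ^ 2) by ring, real_smul] at h1
    rw [hw]
    simp only
    rw [h1, mul_add, ← mul_assoc, ← ofReal_mul, ← Real.exp_add, add_neg_cancel, Real.exp_zero,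
      ofReal_one, one_mul]
    congr 1
    rw [mul_left_comm, ← mul_assoc (((Real.exp (τ / ε ^ 2) : ℝ)) : ℂ), ← ofReal_mul,
      ← Real.exp_add, add_neg_cancel, Real.exp_zero, ofReal_one, one_mul]
  have hsol := eq_mul_exp_of_eq_add_integral ht.le hmc hwc heq
  have hint : ∫ σ in (0 : ℝ)..t, m σ = t * charFun (relaxedJumpMeasure J t) (ε • ξ) := by
    rw [charFun_relaxedJumpMeasure hJ ht, ← mul_assoc, ← ofReal_mul, mul_inv_cancel₀ ht.ne',
      ofReal_one, one_mul]
  rw [hint, hw] at hsol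
  simp only [sub_self, Real.exp_zero, one_smul] at hsol
  have hfin : fourierMode (u t) ξ = (Real.exp (-(t / ε ^ 2)) : ℝ) *
      ((Real.exp (t / ε ^ 2) : ℝ) * fourierMode (u t) ξ) := by
    rw [← mul_assoc, ← ofReal_mul, ← Real.exp_add, neg_add_cancel, Real.exp_zero, ofReal_one,
      one_mul]
  rw [hfin, hsol, mul_left_comm, ofReal_exp, ← Complex.exp_add]
  congr 2
  push_cast
  ring

end NLFP

end MildSolution

/-! ### Uniform lower bound for compound Poisson laws. -/

section CompoundPoisson

open Filter Topology Complex Module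
open scoped RealInnerProductSpace

variable {E : Type*} [NormedAddCommGroup E] [InnerProductSpace ℝ E] [FiniteDimensional ℝ E]
  [MeasurableSpace E] [BorelSpace E]

lemma real_hasSum_exp (x : ℝ) : HasSum (fun n : ℕ => x ^ n / n.factorial) (Real.exp x) := by
  rw [Real.exp_eq_exp_ℝ]
  exact NormedSpace.expSeries_div_hasSum_exp x

lemma complex_hasSum_exp (x : ℂ) : HasSum (fun n : ℕ => x ^ n / n.factorial) (cexp x) := by
  rw [Complex.exp_eq_exp_ℂ]
  exact NormedSpace.expSeries_div_hasSum_exp x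

/-- The weights of the Poisson distribution. -/
noncomputable def poissonWeight (l : ℝ) (n : ℕ) : ℝ := Real.exp (-l) * (l ^ n / n.factorial)

lemma poissonWeight_nonneg {l : ℝ} (hl : 0 ≤ l) (n : ℕ) : 0 ≤ poissonWeight l n := by
  unfold poissonWeight; positivity

/-- The generating function: `x = 1` gives the total mass, `x = 2` and `x = 1 / 2` the Chernoff
bounds for the two tails. -/
lemma hasSum_poissonWeight_mul_pow (l x : ℝ) :
    HasSum (fun n => poissonWeight l n * x ^ n) (Real.exp (-l + l * x)) := by
  rw [Real.exp_add]
  refine ((real_hasSum_exp (l * x)).mul_left (Real.exp (-l))).congr_fun ?_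
  intro n
  rw [poissonWeight, mul_pow]
  ring

/-- Eventually at least half of the Poisson mass sits between half the mean and twice the mean. -/
lemma eventually_half_le_tsum_poissonWeight :
    ∀ᶠ l : ℝ in atTop, ENNReal.ofReal (1 / 2) ≤ ∑' n : ℕ, ENNReal.ofReal
      ({n : ℕ | l / 2 ≤ n ∧ (n : ℝ) ≤ 2 * l}.indicator (poissonWeight l) n) := by
  have hlog1 : Real.log 2 < 1 := by linarith [Real.log_two_lt_d9]
  have hlog2 : 1 / 2 < Real.log 2 := by linarith [Real.log_two_gt_d9]
  have hlim : Tendsto (fun l : ℝ => 1 - Real.exp (-(2 * Real.log 2 - 1) * l) -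
      Real.exp (-((1 - Real.log 2) / 2) * l)) atTop (𝓝 1) := by
    have h1 : ∀ c : ℝ, 0 < c → Tendsto (fun l : ℝ => Real.exp (-c * l)) atTop (𝓝 0) := by
      intro c hc
      refine Real.tendsto_exp_atBot.comp ?_
      exact tendsto_id.const_mul_atTop_of_neg (by linarith)
    have := (tendsto_const_nhds (x := (1 : ℝ))).sub (h1 (2 * Real.log 2 - 1) (by linarith))
      |>.sub (h1 ((1 - Real.log 2) / 2) (by linarith))
    simpa using this
  filter_upwards [hlim.eventually (le_mem_nhds (show (1 / 2 : ℝ) < 1 by norm_num)),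
    eventually_ge_atTop 0] with l hl hl0
  set S : Set ℕ := {n : ℕ | l / 2 ≤ n ∧ (n : ℝ) ≤ 2 * l} with hS
  have hsum1 : HasSum (fun n => poissonWeight l n) 1 := by
    simpa using hasSum_poissonWeight_mul_pow l 1
  -- Chernoff bound: the subtracted terms are the weights times `2 ^ (n - 2l)` and `2 ^ (l/2 - n)`,
  -- which are at least `1` for `n > 2l` and `n < l/2` respectively. The summand is thus nonpositive
  -- off the window.
  have hg : HasSum (fun n => poissonWeight l n - poissonWeight l n * 2 ^ n *
      Real.exp (-(2 * Real.log 2 * l)) - poissonWeight l n * (1 / 2) ^ n *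
      Real.exp (Real.log 2 / 2 * l)) (1 - Real.exp (-(2 * Real.log 2 - 1) * l) -
      Real.exp (-((1 - Real.log 2) / 2) * l)) := by
    have h2 := (hasSum_poissonWeight_mul_pow l 2).mul_right (Real.exp (-(2 * Real.log 2 * l)))
    have h3 := (hasSum_poissonWeight_mul_pow l (1 / 2)).mul_right (Real.exp (Real.log 2 / 2 * l))
    rw [← Real.exp_add] at h2 h3
    rw [show -l + l * 2 + -(2 * Real.log 2 * l) = -(2 * Real.log 2 - 1) * l by ring] at h2
    rw [show -l + l * (1 / 2) + Real.log 2 / 2 * l = -((1 - Real.log 2) / 2) * l by ring] at h3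
    exact (hsum1.sub h2).sub h3
  have hSs : Summable (S.indicator (poissonWeight l)) := hsum1.summable.indicator S
  rw [← ENNReal.ofReal_tsum_of_nonneg
    (fun n => Set.indicator_nonneg (fun n _ => poissonWeight_nonneg hl0 n) n) hSs]
  refine ENNReal.ofReal_le_ofReal (hl.trans ?_)
  refine hasSum_le (fun n => ?_) hg hSs.hasSum
  have hp := poissonWeight_nonneg hl0 n
  have hA : 0 ≤ poissonWeight l n * 2 ^ n * Real.exp (-(2 * Real.log 2 * l)) := by positivity
  have hB : 0 ≤ poissonWeight l n * (1 / 2) ^ n * Real.exp (Real.log 2 / 2 * l) := by positivity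
  have h2n : (2 : ℝ) ^ n = Real.exp (n * Real.log 2) := by
    rw [Real.exp_nat_mul, Real.exp_log two_pos]
  by_cases hn : n ∈ S
  · rw [Set.indicator_of_mem hn]
    linarith
  · rw [Set.indicator_of_notMem hn]
    have hn' : (n : ℝ) < l / 2 ∨ 2 * l < n := by
      by_contra h
      push Not at h
      exact hn h
    rcases hn' with h | h
    · have : 1 ≤ (1 / 2 : ℝ) ^ n * Real.exp (Real.log 2 / 2 * l) := by
        rw [one_div, inv_pow, h2n, ← Real.exp_neg, ← Real.exp_add, Real.one_le_exp_iff]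
        nlinarith
      nlinarith
    · have : 1 ≤ (2 : ℝ) ^ n * Real.exp (-(2 * Real.log 2 * l)) := by
        rw [h2n, ← Real.exp_add, Real.one_le_exp_iff]
        nlinarith
      nlinarith

/-- The law of `ε` times a Poisson(`l`) number of independent `μ`-distributed summands. -/
noncomputable def compoundPoisson (μ : Measure E) (ε l : ℝ) : Measure E :=
  Measure.sum fun n => ENNReal.ofReal (poissonWeight l n) • (convPow μ n).map fun x => ε • x

variable (μ : Measure E) [IsProbabilityMeasure μ]

lemma isProbabilityMeasure_compoundPoisson (ε : ℝ) {l : ℝ} (hl : 0 ≤ l) :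
    IsProbabilityMeasure (compoundPoisson μ ε l) := by
  constructor
  rw [compoundPoisson, Measure.sum_apply _ MeasurableSet.univ]
  have h : ∀ n, (ENNReal.ofReal (poissonWeight l n) • (convPow μ n).map fun x => ε • x) Set.univ =
      ENNReal.ofReal (poissonWeight l n) := by
    intro n
    rw [Measure.smul_apply, Measure.map_apply (by fun_prop) MeasurableSet.univ, Set.preimage_univ,
      measure_univ, smul_eq_mul, mul_one]
  simp_rw [h]
  have hsum1 : HasSum (fun n => poissonWeight l n) 1 := by
    simpa using hasSum_poissonWeight_mul_pow l 1
  rw [← ENNReal.ofReal_tsum_of_nonneg (poissonWeight_nonneg hl) hsum1.summable, hsum1.tsum_eq,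
    ENNReal.ofReal_one]

lemma charFun_compoundPoisson (ε : ℝ) {l : ℝ} (hl : 0 ≤ l) (ξ : E) :
    charFun (compoundPoisson μ ε l) ξ = cexp (l * (charFun μ (ε • ξ) - 1)) := by
  have := isProbabilityMeasure_compoundPoisson μ ε hl
  have hi : Integrable (fun x => cexp (⟪x, ξ⟫ * I)) (compoundPoisson μ ε l) :=
    (integrable_const (1 : ℝ)).mono' (Continuous.aestronglyMeasurable (by fun_prop))
      (Eventually.of_forall fun p => (norm_exp_ofReal_mul_I _).le)
  have h1 := hasSum_integral_measure hi
  have h2 : ∀ n, ∫ x, cexp (⟪x, ξ⟫ * I)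
      ∂(ENNReal.ofReal (poissonWeight l n) • (convPow μ n).map fun x => ε • x) =
      cexp (-l) * ((l * charFun μ (ε • ξ)) ^ n / n.factorial) := by
    intro n
    rw [← charFun_apply, charFun_smul_measure, charFun_map_smul, charFun_convPow,
      ENNReal.toReal_ofReal (poissonWeight_nonneg hl n), poissonWeight]
    push_cast
    ring
  simp_rw [h2] at h1
  have h3 := (complex_hasSum_exp (l * charFun μ (ε • ξ))).mul_left (cexp (-l))
  rw [← Complex.exp_add] at h3
  rw [charFun_apply]
  refine (h1.unique h3).trans ?_
  congr 1
  ring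

/-- Dilation by `r` divides densities by `r ^ finrank ℝ E`. Using only bounds on `r` gives a
constant valid for a whole range of dilations. -/
lemma smul_restrict_ball_le_map_smul {ν : Measure E} {c K r R M : ℝ} (hr : 0 < r) (hR : R ≤ K * r)
    (hM : r ≤ M) (h : ENNReal.ofReal c • volume.restrict (Metric.ball (0 : E) K) ≤ ν) :
    ENNReal.ofReal (c * (M ^ finrank ℝ E)⁻¹) • volume.restrict (Metric.ball (0 : E) R) ≤
      ν.map fun x => r • x := by
  refine Measure.le_iff.2 fun A hA => ?_
  have hm : Measurable fun x : E => r • x := by fun_prop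
  rw [Measure.smul_apply, Measure.restrict_apply hA, Measure.map_apply hm hA, smul_eq_mul]
  refine le_trans ?_ (h _)
  rw [Measure.smul_apply, Measure.restrict_apply (hm hA), smul_eq_mul]
  have hsub : (fun x : E => r • x) ⁻¹' (A ∩ Metric.ball 0 R) ⊆
      (fun x : E => r • x) ⁻¹' A ∩ Metric.ball 0 K := by
    rintro x ⟨hxA, hxR⟩
    refine ⟨hxA, ?_⟩
    simp only [mem_ball_zero_iff, norm_smul, Real.norm_of_nonneg hr.le] at hxR ⊢
    nlinarith
  refine le_trans ?_ (mul_le_mul_right (measure_mono hsub) _)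
  rw [Measure.addHaar_preimage_smul _ hr.ne', ← mul_assoc, mul_comm c,
    ENNReal.ofReal_mul (by have := hr.trans_le hM; positivity), mul_comm (ENNReal.ofReal (M ^ _)⁻¹)]
  gcongr
  refine (inv_anti₀ (by positivity) ?_).trans (le_abs_self _)
  gcongr

/-- Uniformly in the jump size `ε ∈ (0, 1]`, the compound Poisson law with jump rate `t / ε²`
dominates a multiple of Lebesgue measure on a given ball. -/
theorem exists_smul_restrict_ball_le_compoundPoisson (hac : μ ≪ volume) {a : ℝ} (ha : 0 < a)
    (hμ : (fun ξ : E => charFun μ ξ - (1 - a * ‖ξ‖ ^ 2 : ℝ)) =o[𝓝 0] fun ξ => ‖ξ‖ ^ 2)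
    {t : ℝ} (ht : 0 < t) {R : ℝ} (hR : 0 < R) :
    ∃ α > 0, ∀ ε ∈ Set.Ioc (0 : ℝ) 1,
      ENNReal.ofReal α • volume.restrict (Metric.ball (0 : E) R) ≤
        compoundPoisson μ ε (t / ε ^ 2) := by
  -- `ε Sₙ = (ε √n) (Sₙ / √n)`, so only the size of `ε √n` matters.
  have hscale : ∀ {c K M ε : ℝ} {n : ℕ}, n ≠ 0 → 0 < ε → R ≤ K * (ε * √n) → ε * √n ≤ M →
      ENNReal.ofReal c • volume.restrict (Metric.ball (0 : E) K) ≤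
        (convPow μ n).map (fun x => (√n)⁻¹ • x) →
      ENNReal.ofReal (c * (M ^ finrank ℝ E)⁻¹) • volume.restrict (Metric.ball (0 : E) R) ≤
        (convPow μ n).map fun x => ε • x := by
    intro c K M ε n hn hε hRK hM h
    have hsn : 0 < √(n : ℝ) := Real.sqrt_pos.2 (by positivity)
    have := smul_restrict_ball_le_map_smul (mul_pos hε hsn) hRK hM h
    rw [Measure.map_map (by fun_prop) (by fun_prop)] at this
    convert this using 2
    ext x
    simp only [Function.comp]
    rw [smul_smul, mul_assoc, mul_inv_cancel₀ hsn.ne', mul_one]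
  -- small `ε`
  obtain ⟨c, hc, hcK⟩ := exists_smul_volume_restrict_ball_le_map_convPow μ hac ha hμ (R / √(t / 2))
  have hst : 0 < √(t / 2) := Real.sqrt_pos.2 (by positivity)
  have hst2 : 0 < √(2 * t) := Real.sqrt_pos.2 (by positivity)
  obtain ⟨N, hN⟩ := eventually_atTop.1 hcK
  obtain ⟨L, hL⟩ := eventually_atTop.1 (eventually_half_le_tsum_poissonWeight)
  -- Beyond `L` the window has mass one half, beyond `2N` all its `n` are in the range of the local
  -- limit theorem, and `1` ensures positivity.
  set l₀ : ℝ := max (max L (2 * N)) 1 with hl₀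
  have hsmall : ∀ ε : ℝ, 0 < ε → l₀ ≤ t / ε ^ 2 →
      ENNReal.ofReal (1 / 2 * (c * (√(2 * t) ^ finrank ℝ E)⁻¹)) •
        volume.restrict (Metric.ball (0 : E) R) ≤ compoundPoisson μ ε (t / ε ^ 2) := by
    intro ε hε hl
    set l := t / ε ^ 2 with hldef
    have hl1 : 1 ≤ l := (le_max_right _ _).trans hl
    have hlN : 2 * N ≤ l := (le_max_right _ _).trans ((le_max_left _ _).trans hl)
    have hlL : L ≤ l := (le_max_left _ _).trans ((le_max_left _ _).trans hl)
    have hεl : ε ^ 2 * l = t := by rw [hldef]; field_simp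
    set c' := c * (√(2 * t) ^ finrank ℝ E)⁻¹ with hc'
    set S : Set ℕ := {n : ℕ | l / 2 ≤ n ∧ (n : ℝ) ≤ 2 * l} with hS
    have hwin : ∀ n ∈ S, ENNReal.ofReal c' • volume.restrict (Metric.ball (0 : E) R) ≤
        (convPow μ n).map fun x => ε • x := by
      rintro n ⟨hn1, hn2⟩
      have hnpos : (0 : ℝ) < n := by linarith
      have hεn : ε * √(n : ℝ) = √(ε ^ 2 * n) := by
        rw [Real.sqrt_mul (by positivity), Real.sqrt_sq hε.le]
      refine hscale (by exact_mod_cast hnpos.ne') hε ?_ ?_ (hN n ?_)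
      · rw [hεn]
        have h1 : √(t / 2) ≤ √(ε ^ 2 * n) := by
          refine Real.sqrt_le_sqrt ?_
          calc t / 2 = ε ^ 2 * (l / 2) := by rw [← hεl]; ring
            _ ≤ _ := by gcongr
        calc R = R / √(t / 2) * √(t / 2) := by field_simp
          _ ≤ _ := by gcongr
      · rw [hεn]
        refine Real.sqrt_le_sqrt ?_
        calc ε ^ 2 * n ≤ ε ^ 2 * (2 * l) := by gcongr
          _ = 2 * t := by rw [← hεl]; ring
      · have : (N : ℝ) ≤ n := by linarith
        exact_mod_cast this
    refine Measure.le_iff.2 fun A hA => ?_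
    rw [compoundPoisson, Measure.sum_apply _ hA, Measure.smul_apply, smul_eq_mul,
      ENNReal.ofReal_mul (by norm_num), mul_assoc]
    calc _ ≤ (∑' n : ℕ, ENNReal.ofReal (S.indicator (poissonWeight l) n)) *
          (ENNReal.ofReal c' * volume.restrict (Metric.ball (0 : E) R) A) :=
          mul_le_mul_left (hL l hlL) _
      _ = ∑' n : ℕ, ENNReal.ofReal (S.indicator (poissonWeight l) n) *
          (ENNReal.ofReal c' * volume.restrict (Metric.ball (0 : E) R) A) :=
          ENNReal.tsum_mul_right.symm
      _ ≤ _ := by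
          refine ENNReal.tsum_le_tsum fun n => ?_
          by_cases hn : n ∈ S
          · rw [Set.indicator_of_mem hn, Measure.smul_apply, smul_eq_mul]
            exact mul_le_mul_right (hwin n hn A) _
          · simp [Set.indicator_of_notMem hn]
  -- `ε` bounded below
  obtain ⟨c₁, hc₁, hcK₁⟩ := exists_smul_volume_restrict_ball_le_map_convPow μ hac ha hμ 1
  have hl₀pos : 0 < l₀ := lt_of_lt_of_le one_pos (le_max_right _ _)
  set ε₀ : ℝ := √(t / l₀) with hε₀
  have hε₀pos : 0 < ε₀ := Real.sqrt_pos.2 (by positivity)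
  have hlimn : Tendsto (fun n : ℕ => ε₀ * √(n : ℝ)) atTop atTop :=
    (Real.tendsto_sqrt_atTop.comp tendsto_natCast_atTop_atTop).const_mul_atTop hε₀pos
  -- A single `n`, large enough that `ε₀ √n ≥ R`, serves every `ε ∈ [ε₀, 1]`: the unit ball is
  -- stretched over the ball of radius `R`.
  obtain ⟨n, hn, hn0, hnR⟩ := (hcK₁.and ((eventually_ne_atTop 0).and
    (hlimn.eventually_ge_atTop R))).exists
  have hnpos : 0 < √(n : ℝ) := Real.sqrt_pos.2 (by positivity)
  -- A lower bound for the weight of `n` over all rates in `[t, l₀]`.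
  set q : ℝ := Real.exp (-l₀) * (t ^ n / n.factorial) with hq
  have hlarge : ∀ ε ∈ Set.Ioc (0 : ℝ) 1, t / ε ^ 2 ≤ l₀ →
      ENNReal.ofReal (q * (c₁ * (√(n : ℝ) ^ finrank ℝ E)⁻¹)) •
        volume.restrict (Metric.ball (0 : E) R) ≤ compoundPoisson μ ε (t / ε ^ 2) := by
    intro ε hε hl
    have hε0 := hε.1
    have hε1 : ε₀ ≤ ε := by
      rw [hε₀, Real.sqrt_le_left hε0.le, div_le_iff₀ hl₀pos]
      rwa [div_le_iff₀ (by positivity), mul_comm] at hl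
    have htl : t ≤ t / ε ^ 2 := by
      rw [le_div_iff₀ (by positivity)]
      exact mul_le_of_le_one_right ht.le (pow_le_one₀ hε0.le hε.2)
    have hp : q ≤ poissonWeight (t / ε ^ 2) n := by
      rw [hq, poissonWeight]
      gcongr
    have h1 := hscale (M := √(n : ℝ)) hn0 hε0 (by
      rw [one_mul]
      exact hnR.trans (by gcongr)) (mul_le_of_le_one_left hnpos.le hε.2) hn
    refine le_trans ?_ (Measure.le_sum _ n)
    refine Measure.le_iff.2 fun A hA => ?_
    rw [Measure.smul_apply, Measure.smul_apply, ENNReal.ofReal_mul (by positivity), smul_eq_mul,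
      smul_eq_mul, mul_assoc]
    exact mul_le_mul' (ENNReal.ofReal_le_ofReal hp) (h1 A)
  refine ⟨min (1 / 2 * (c * (√(2 * t) ^ finrank ℝ E)⁻¹))
    (q * (c₁ * (√(n : ℝ) ^ finrank ℝ E)⁻¹)), lt_min (by positivity) (by positivity),
    fun ε hε => ?_⟩
  rcases le_total l₀ (t / ε ^ 2) with h | h
  · refine le_trans (Measure.le_iff.2 fun A hA => ?_) (hsmall ε hε.1 h)
    rw [Measure.smul_apply, Measure.smul_apply]
    exact mul_le_mul_left (ENNReal.ofReal_le_ofReal (min_le_left _ _)) _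
  · refine le_trans (Measure.le_iff.2 fun A hA => ?_) (hlarge ε hε h)
    rw [Measure.smul_apply, Measure.smul_apply]
    exact mul_le_mul_left (ENNReal.ofReal_le_ofReal (min_le_right _ _)) _

/-- For `y` in the ball of radius `R₂`, translating a subset of the ball of radius `R₁` by `-y`
keeps it in the ball of radius `R₁ + R₂`; each such `y` contributes `c` times its volume. -/
lemma smul_restrict_ball_le_conv {κ ν : Measure E} [IsFiniteMeasure κ] [IsFiniteMeasure ν]
    {c : ENNReal} {R₁ R₂ : ℝ}
    (h : c • volume.restrict (Metric.ball (0 : E) (R₁ + R₂)) ≤ κ) :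
    (c * ν (Metric.ball 0 R₂)) • volume.restrict (Metric.ball (0 : E) R₁) ≤ κ ∗ ν := by
  refine Measure.le_iff.2 fun A hA => ?_
  rw [Measure.smul_apply, Measure.restrict_apply hA, smul_eq_mul]
  have hA' : MeasurableSet (A ∩ Metric.ball 0 R₁) := hA.inter Metric.isOpen_ball.measurableSet
  refine le_trans ?_ (measure_mono (Set.inter_subset_left : A ∩ Metric.ball 0 R₁ ⊆ A))
  set B := A ∩ Metric.ball 0 R₁ with hB
  rw [Measure.conv_comm, ← lintegral_indicator_one (μ := ν ∗ κ) hA', Measure.lintegral_conv (by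
    exact measurable_one.indicator hA')]
  have h1 : ∀ y ∈ Metric.ball (0 : E) R₂, c * volume B ≤ ∫⁻ x, B.indicator 1 (y + x) ∂κ := by
    intro y hy
    have hm : MeasurableSet ((fun x => y + x) ⁻¹' B) := hA'.preimage (by fun_prop)
    have e : ∫⁻ x, B.indicator (1 : E → ENNReal) (y + x) ∂κ = κ ((fun x => y + x) ⁻¹' B) := by
      rw [← lintegral_indicator_one hm]
      rfl
    rw [e]
    refine le_trans ?_ (h _)
    rw [Measure.smul_apply, Measure.restrict_apply hm, smul_eq_mul]
    have hsub : (fun x => y + x) ⁻¹' B ∩ Metric.ball 0 (R₁ + R₂) = (fun x => y + x) ⁻¹' B := by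
      refine Set.inter_eq_left.2 fun x hx => ?_
      have hx1 : ‖y + x‖ < R₁ := mem_ball_zero_iff.1 hx.2
      have hy1 : ‖y‖ < R₂ := mem_ball_zero_iff.1 hy
      rw [mem_ball_zero_iff]
      calc ‖x‖ = ‖(y + x) - y‖ := by rw [add_sub_cancel_left]
        _ ≤ ‖y + x‖ + ‖y‖ := norm_sub_le _ _
        _ < _ := by linarith
    rw [hsub, measure_preimage_add]
  calc c * ν (Metric.ball 0 R₂) * volume B = ∫⁻ y in Metric.ball (0 : E) R₂, c * volume B ∂ν := by
        rw [setLIntegral_const]; ring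
    _ ≤ ∫⁻ y in Metric.ball (0 : E) R₂, (∫⁻ x, B.indicator 1 (y + x) ∂κ) ∂ν :=
        setLIntegral_mono' Metric.isOpen_ball.measurableSet h1
    _ ≤ _ := setLIntegral_le_lintegral _ _

end CompoundPoisson

/-! ### Identification of the solution and conclusion. -/

section LowerBound

open Filter Topology Complex
open scoped RealInnerProductSpace

namespace NLFP

variable {d : ℕ} {J : Space d → ℝ}

lemma isFiniteMeasure_withDensity_ofReal' {f : Space d → ℝ} (hf : Integrable f) :
    IsFiniteMeasure ((volume : Measure (Space d)).withDensity fun x => ENNReal.ofReal (f x)) :=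
  isFiniteMeasure_withDensity_ofReal hf.2

lemma charFun_withDensity_ofReal {f : Space d → ℝ} (hf : Integrable f) (ξ : Space d) :
    charFun (volume.withDensity fun x => ENNReal.ofReal (f x)) ξ =
      fourierMode (fun x => max (f x) 0) ξ := by
  rw [charFun_apply, integral_withDensity_eq_integral_toReal_smul₀
    hf.1.aemeasurable.ennreal_ofReal (Eventually.of_forall fun x => ENNReal.ofReal_lt_top),
    fourierMode]
  congr with x
  rw [ENNReal.toReal_ofReal', real_smul, mul_comm]

/-- A function whose Fourier transform is the characteristic function of a finite measure is
nonnegative, and its density measure dominates that measure. -/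
lemma nonneg_and_le_withDensity_of_charFun_eq {f : Space d → ℝ} (hf : Integrable f)
    {P : Measure (Space d)} [IsFiniteMeasure P] (hP : ∀ ξ, charFun P ξ = fourierMode f ξ) :
    (∀ᵐ x, 0 ≤ f x) ∧ P ≤ volume.withDensity fun x => ENNReal.ofReal (f x) := by
  have h1 := isFiniteMeasure_withDensity_ofReal' hf
  have hfn : Integrable fun x => -f x := hf.neg
  have h2 := isFiniteMeasure_withDensity_ofReal' hfn
  -- `f⁺ = f⁻ + f`, written between positive measures so that uniqueness of characteristic functions
  -- applies.
  have heq : (volume.withDensity fun x => ENNReal.ofReal (f x)) =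
      (volume.withDensity fun x => ENNReal.ofReal (-f x)) + P := by
    refine Measure.ext_of_charFun (funext fun ξ => ?_)
    rw [charFun_add_measure, hP, charFun_withDensity_ofReal hf,
      charFun_withDensity_ofReal hfn, fourierMode, fourierMode, fourierMode,
      ← integral_add (integrable_cexp_mul hfn.pos_part ξ)
        (integrable_cexp_mul hf ξ)]
    congr with x
    rw [← mul_add, ← ofReal_add]
    congr 2
    rcases le_total 0 (f x) with h | h
    · rw [max_eq_left h, max_eq_right (by linarith), zero_add]
    · rw [max_eq_right h, max_eq_left (by linarith), neg_add_cancel]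
  refine ⟨?_, heq ▸ Measure.le_add_left le_rfl⟩
  -- The measure with density `f⁺` does not charge `{f < 0}`; by `heq` neither does the one with
  -- density `f⁻`, so that set is null. A measurable representative makes the set measurable.
  obtain ⟨g, hgm, hfg⟩ := hf.1
  have hfg' : ∀ᵐ x, f x = g x := hfg
  have hN : MeasurableSet {x | g x < 0} := measurableSet_lt hgm.measurable measurable_const
  have h3 : (volume.withDensity fun x => ENNReal.ofReal (f x)) {x | g x < 0} = 0 := by
    rw [withDensity_apply _ hN, setLIntegral_eq_zero_iff' hN hf.1.aemeasurable.ennreal_ofReal.restrict]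
    filter_upwards [hfg'] with x hx hx0
    exact ENNReal.ofReal_of_nonpos (by rw [hx]; exact le_of_lt hx0)
  rw [heq, Measure.add_apply, add_eq_zero] at h3
  have h4 := h3.1
  rw [withDensity_apply _ hN, setLIntegral_eq_zero_iff' hN
    hfn.1.aemeasurable.ennreal_ofReal.restrict] at h4
  filter_upwards [h4, hfg'] with x hx hxg
  by_contra hneg
  have h5 := hx (show g x < 0 by rw [← hxg]; exact not_le.1 hneg)
  rw [ENNReal.ofReal_eq_zero] at h5
  linarith

/-- **Lower bound** for mild solutions, uniform in the scaling parameter `ε ∈ (0, 1]`. -/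
theorem exists_pos_forall_mildSolution_ge (hJ : IsNormalizedKernel J) {s : ℝ}
    (hs : s ∈ Set.Ioc (0 : ℝ) 1) (hJs : Integrable fun x => J x * ‖x‖ ^ (2 + s)) {t : ℝ}
    (ht : 0 < t) {R₁ R₂ : ℝ} (hR₁ : 0 < R₁) (hR₂ : 0 < R₂) :
    ∃ α : ℝ, 0 < α ∧ ∀ ε ∈ Set.Ioc (0 : ℝ) 1, ∀ k : ℝ, ∀ u₀ : Space d → ℝ,
      MemLp u₀ 1 (weightedMeasure d k) → (∀ᵐ x, 0 ≤ u₀ x) → ∀ T : EReal, (t : EReal) < T →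
        ∀ u : ℝ → WeightedL1 d k, IsMildSolution J ε k T u₀ u →
          ∀ᵐ x, x ∈ Metric.ball (0 : Space d) R₁ →
            α * ∫ y in Metric.ball (0 : Space d) R₂, u₀ y ≤ u t x := by
  have hprob := isProbabilityMeasure_relaxedJumpMeasure hJ ht
  obtain ⟨α, hα, hαP⟩ := exists_smul_restrict_ball_le_compoundPoisson (relaxedJumpMeasure J t)
    (relaxedJumpMeasure_absolutelyContinuous hJ) (integral_exp_two_mul_sub_pos ht)
    (isLittleO_charFun_relaxedJumpMeasure hJ hs hJs ht) ht (add_pos hR₁ hR₂)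
  refine ⟨α, hα, fun ε hε k u₀ hu₀k hu₀ T hT u hu => ?_⟩
  have hu₀i : Integrable u₀ :=
    (memLp_one_iff_integrable.1 hu₀k).mono_measure (volume_le_weightedMeasure k)
  have hl : 0 ≤ t / ε ^ 2 := by positivity
  set κ := compoundPoisson (relaxedJumpMeasure J t) ε (t / ε ^ 2) with hκ
  have hκp : IsProbabilityMeasure κ := isProbabilityMeasure_compoundPoisson _ _ hl
  set ν₀ : Measure (Space d) := volume.withDensity fun x => ENNReal.ofReal (u₀ x) with hν₀
  have hν₀f : IsFiniteMeasure ν₀ := isFiniteMeasure_withDensity_ofReal' hu₀i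
  set ν : Measure (Space d) := ν₀.map fun x => Real.exp (-t) • x with hν
  -- `κ` is the law of the accumulated jumps, `ν` that of the contracted initial position.
  have hchar : ∀ ξ, charFun (κ ∗ ν) ξ = fourierMode (u t) ξ := by
    intro ξ
    have h0 : charFun ν₀ (Real.exp (-t) • ξ) = fourierMode u₀ (Real.exp (-t) • ξ) := by
      rw [hν₀, charFun_withDensity_ofReal hu₀i]
      refine fourierMode_congr_ae ?_ _
      filter_upwards [hu₀] with x hx
      exact max_eq_left hx
    rw [charFun_conv, hκ, charFun_compoundPoisson _ _ hl, hν, charFun_map_smul, h0,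
      hu.fourierMode_eq hJ hε.1 ht hT, mul_comm]
  obtain ⟨hnn, hle⟩ := nonneg_and_le_withDensity_of_charFun_eq (u t).integrable hchar
  have hconv := (smul_restrict_ball_le_conv (ν := ν) (hαP ε hε)).trans hle
  set q : ℝ := ∫ y in Metric.ball (0 : Space d) R₂, u₀ y with hq
  -- The drift maps the ball of radius `R₂` into itself, so its mass cannot escape.
  have hνq : ENNReal.ofReal q ≤ ν (Metric.ball 0 R₂) := by
    have hm : Measurable fun x : Space d => Real.exp (-t) • x := by fun_prop
    rw [hν, Measure.map_apply hm Metric.isOpen_ball.measurableSet]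
    calc ENNReal.ofReal q = ν₀ (Metric.ball 0 R₂) := by
          rw [hq, hν₀, withDensity_apply _ Metric.isOpen_ball.measurableSet,
            ofReal_integral_eq_lintegral_ofReal hu₀i.integrableOn (ae_restrict_of_ae hu₀)]
      _ ≤ _ := by
          refine measure_mono fun x hx => ?_
          simp only [Set.mem_preimage, mem_ball_zero_iff, norm_smul,
            Real.norm_of_nonneg (Real.exp_pos _).le] at hx ⊢
          have := Real.exp_le_one_iff.2 (neg_nonpos.2 ht.le)
          exact (mul_le_of_le_one_left (norm_nonneg _) this).trans_lt hx
  -- The inequality between measures, tested on all measurable sets, gives the inequality between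
  -- densities almost everywhere.
  have hae : (fun x => (Metric.ball (0 : Space d) R₁).indicator
      (fun _ => ENNReal.ofReal (α * q)) x) ≤ᵐ[volume] fun x => ENNReal.ofReal (u t x) := by
    refine ae_le_of_forall_setLIntegral_le_of_sigmaFinite₀
      (measurable_const.indicator Metric.isOpen_ball.measurableSet).aemeasurable
      fun A hA _ => ?_
    have h1 := hconv A
    rw [Measure.smul_apply, Measure.restrict_apply hA, smul_eq_mul,
      withDensity_apply _ hA] at h1
    refine le_trans ?_ h1
    rw [lintegral_indicator Metric.isOpen_ball.measurableSet,
      Measure.restrict_restrict Metric.isOpen_ball.measurableSet, setLIntegral_const,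
      Set.inter_comm, ENNReal.ofReal_mul hα.le]
    gcongr
  filter_upwards [hae, hnn] with x hx hx0 hxR
  simp only [Set.indicator_of_mem hxR] at hx
  exact (ENNReal.ofReal_le_ofReal_iff hx0).1 hx

end NLFP

end LowerBound

theorem theorem3p10 (d : ℕ) (hd : 1 ≤ d) (J : NLFP.Space d → ℝ)
    (hJ : NLFP.IsNormalizedKernel J)
    (s : ℝ) (hs : s ∈ Set.Ioc (0 : ℝ) 1) (hJs : Integrable fun x => J x * ‖x‖ ^ (2 + s))
    (p : ENNReal) (hp : 1 < p) (hJp : MemLp J p)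
    (t : ℝ) (ht : 0 < t) (R₁ : ℝ) (hR₁ : 0 < R₁) (R₂ : ℝ) (hR₂ : 0 < R₂) :
    ∃ α : ℝ, 0 < α ∧
      ∀ ε ∈ Set.Ioc (0 : ℝ) 1, ∀ k : ℝ, 0 ≤ k →
        ∀ u₀ : NLFP.Space d → ℝ, MemLp u₀ 1 (NLFP.weightedMeasure d k) →
          (∀ᵐ x, 0 ≤ u₀ x) → ∫ x, u₀ x = 1 →
          ∀ T : EReal, (t : EReal) < T →
            ∀ u : ℝ → NLFP.WeightedL1 d k, NLFP.IsMildSolution J ε k T u₀ u →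
              ∀ᵐ x, x ∈ Metric.ball (0 : NLFP.Space d) R₁ →
                α * ∫ y in Metric.ball (0 : NLFP.Space d) R₂, u₀ y ≤ u t x := by
  obtain ⟨α, hα, h⟩ := NLFP.exists_pos_forall_mildSolution_ge hJ hs hJs ht hR₁ hR₂
  exact ⟨α, hα, fun ε hε k _ u₀ hu₀k hu₀ _ => h ε hε k u₀ hu₀k hu₀⟩
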